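/- **Lemma 2 (Pure fermionic Gaussian states).** Let $n\ge 0$ and $k=2n$. On the fermionic Fock space of $k$ modes with annihilation operators $f_1,\dots,f_k$, let $m_{2j-1}=f_j^\dagger+f_j$, $m_{2j}=i(f_j^\dagger-f_j)$ be the Majorana operators; subsystem $A$ consists of the first $n$ modes ($m_1,\dots,m_{2n}$) and subsystem $B$ of the last $n$ modes ($m_{2n+1},\dots,m_{4n}$). Let $\rho$ be a fermionic state (a density operator commuting with the parity operator $m_1m_2\cdots m_{2k}$) with covariance matrix $\gamma_{j,l}=\frac i2\operatorname{tr}(\rho[m_j,m_l])$. Suppose that $\rho$ is Gaussian, i.e. for all $p$ and all pairwise distinct indices $j_1,\dots,j_{2p}$ $$\operatorname{tr}(\rho\, m_{j_1}\cdots m_{j_{2p}})=(-i)^p\sum_{\pi}\operatorname{sgn}(\pi)\prod_{l=1}^p\gamma_{j_{\pi(2l-1)},j_{\pi(2l)}},$$ where the sum runs over all pairings $\pi$ of $\{1,\dots,2p\}$, and that $\rho$ is pure, i.e. $\rho=|\psi\rangle\langle\psi|$ for some vector $\psi$. Expand $\rho=\sum_{\tau\in\{0,1\}^{2k}}w_\tau\,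 m_1^{\tau_1}\cdots m_{2k}^{\tau_{2k}}$ and define its partial transpose by $$\rho^{T_B}=\sum_\tau(-1)^{f(\tau)}w_\tau\, m_1^{\tau_1}\cdots m_{2k}^{\tau_{2k}},$$ where $f(\tau)=0$ if $\sum_{j>2n}\tau_j \bmod 4\in\{0,1\}$ and $f(\tau)=1$ otherwise. Let $\mathcal N=\frac12(\|\rho^{T_B}\|_1-1)$ be the entanglement negativity, where $\|\cdot\|_1$ is the trace norm, and let $\gamma_A$ be the upper left $2n\times 2n$ block of $\gamma$. Then the spectrum of $\gamma_A$, counted with multiplicity, has the form $\{\pm i a_j\}_{j=1}^n$ with real $a_j$, and for every such choice of $a_1,\dots,a_n$ one has $|a_j|\le 1$ for all $j$ and $$\mathcal N=\frac12\Bigl(\prod_{j=1}^n g(a_j)-1\Bigr),\qquad g(a)=1+\sqrt{1-a^2}.$$ -/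

import Mathlib

open scoped Matrix ComplexOrder

noncomputable section

namespace FermionicNegativity

/-- Operators on the fermionic Fock space of `k` modes, as complex matrices in the occupation
number basis `|S⟩`, where `S` is the set of occupied modes. -/
abbrev FockOp (k : ℕ) : Type := Matrix (Finset (Fin k)) (Finset (Fin k)) ℂ

/-- The annihilation operator `f_j`: for `j ∈ T` it maps `|T⟩` to
`(-1)^{#{i ∈ T : i < j}} |T \ {j}⟩`, and it maps `|T⟩` to `0` if `j ∉ T`. -/
def annihilation {k : ℕ} (j : Fin k) : FockOp k :=
  fun S T => if j ∈ T ∧ S = T.erase j then (-1) ^ (T.filter (fun i => i < j)).card else 0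

/-- The creation operator `f_j†`. -/
def creation {k : ℕ} (j : Fin k) : FockOp k := (annihilation j)ᴴ

/-- The fermionic mode to which the Majorana operator with (zero-based) index `j` belongs. -/
def modeOf {k : ℕ} (j : Fin (2 * k)) : Fin k :=
  ⟨(j : ℕ) / 2, Nat.div_lt_of_lt_mul j.isLt⟩

/-- The Majorana operators: with indices counted from `0`, the mode `j` gives
`m_{2j} = f_j† + f_j` and `m_{2j+1} = i (f_j† - f_j)`. -/
def majorana {k : ℕ} (j : Fin (2 * k)) : FockOp k :=
  if (j : ℕ) % 2 = 0 then creation (modeOf j) + annihilation (modeOf j)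
  else Complex.I • (creation (modeOf j) - annihilation (modeOf j))

/-- The ordered product `m_{j_1} m_{j_2} ⋯ m_{j_q}`. -/
def majoranaProd {k q : ℕ} (j : Fin q → Fin (2 * k)) : FockOp k :=
  (List.ofFn fun i => majorana (j i)).prod

/-- The ordered monomial `m_1^{τ_1} m_2^{τ_2} ⋯ m_{2k}^{τ_{2k}}` of a bit string `τ`. -/
def monomial {k : ℕ} (τ : Fin (2 * k) → Fin 2) : FockOp k :=
  (List.ofFn fun i => majorana i ^ (τ i : ℕ)).prod

/-- The parity operator `P = m_1 m_2 ⋯ m_{2k}` (up to a phase). -/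
def parity (k : ℕ) : FockOp k := (List.ofFn fun i : Fin (2 * k) => majorana i).prod

/-- A (physical) fermionic state: a density operator commuting with the parity operator. -/
structure IsFermionicState {k : ℕ} (ρ : FockOp k) : Prop where
  posSemidef : ρ.PosSemidef
  trace_eq_one : ρ.trace = 1
  commute_parity : Commute ρ (parity k)

/-- The state is pure: `ρ = |ψ⟩⟨ψ|` for some vector `ψ`. -/
def IsPure {k : ℕ} (ρ : FockOp k) : Prop :=
  ∃ ψ : Finset (Fin k) → ℂ, ρ = Matrix.vecMulVec ψ (star ψ)

/-- The covariance matrix `γ_{j,l} = (i/2) tr (ρ [m_j, m_l])`. For Hermitian `ρ` this number is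
real, so that taking the real part does not change it. -/
def covariance {k : ℕ} (ρ : FockOp k) : Matrix (Fin (2 * k)) (Fin (2 * k)) ℝ :=
  fun j l => (Complex.I / 2 *
    (ρ * (majorana j * majorana l - majorana l * majorana j)).trace).re

/-- The first element, at (zero-based) position `2 l`, of the `l`-th pair of `Fin (2 * p)`. -/
def fstIdx {p : ℕ} (l : Fin p) : Fin (2 * p) := ⟨2 * (l : ℕ), by omega⟩

/-- The second element, at (zero-based) position `2 l + 1`, of the `l`-th pair. -/
def sndIdx {p : ℕ} (l : Fin p) : Fin (2 * p) := ⟨2 * (l : ℕ) + 1, by omega⟩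

/-- The pairing `{π(1), π(2)}, {π(3), π(4)}, …, {π(2p-1), π(2p)}` of `2p` elements written in its
unique standard order: each pair is increasing, and the pairs are listed by increasing first
elements. -/
def IsPairing {p : ℕ} (π : Equiv.Perm (Fin (2 * p))) : Prop :=
  (∀ l : Fin p, π (fstIdx l) < π (sndIdx l)) ∧
    ∀ l l' : Fin p, l < l' → π (fstIdx l) < π (fstIdx l')

open Classical in
/-- The sum over all pairings `π` of `sgn(π) ∏_l γ_{j_{π(2l-1)}, j_{π(2l)}}`. -/
def wickSum {k p : ℕ} (γ : Matrix (Fin (2 * k)) (Fin (2 * k)) ℝ)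
    (j : Fin (2 * p) → Fin (2 * k)) : ℝ :=
  ∑ π : Equiv.Perm (Fin (2 * p)) with IsPairing π,
    ((Equiv.Perm.sign π : ℤ) : ℝ) * ∏ l : Fin p, γ (j (π (fstIdx l))) (j (π (sndIdx l)))

/-- A fermionic Gaussian state: a fermionic state satisfying the Wick expansion
`tr (ρ m_{j_1} ⋯ m_{j_{2p}}) = (-i)^p ∑_π sgn(π) ∏_l γ_{j_{π(2l-1)}, j_{π(2l)}}`
for pairwise distinct indices. -/
structure IsGaussianState {k : ℕ} (ρ : FockOp k) : Prop extends IsFermionicState ρ where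
  wick : ∀ (p : ℕ) (j : Fin (2 * p) → Fin (2 * k)), Function.Injective j →
    (ρ * majoranaProd j).trace = (-Complex.I) ^ p * ((wickSum (covariance ρ) j : ℝ) : ℂ)

/-- The coefficient `w_τ` in the expansion `ρ = ∑_τ w_τ m_1^{τ_1} ⋯ m_{2k}^{τ_{2k}}`; the monomials
are orthogonal for the Hilbert-Schmidt inner product and have squared norm `2^k`. -/
def coeff {k : ℕ} (ρ : FockOp k) (τ : Fin (2 * k) → Fin 2) : ℂ :=
  ((monomial τ)ᴴ * ρ).trace / 2 ^ k

/-- For subsystems `A` and `B` consisting of the first `nA` and the last `nB` modes, the number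
of Majorana operators of `B` that occur in the monomial of `τ`. -/
def degreeB (nA nB : ℕ) (τ : Fin (2 * (nA + nB)) → Fin 2) : ℕ :=
  ∑ i : Fin (2 * (nA + nB)), if 2 * nA ≤ (i : ℕ) then (τ i : ℕ) else 0

/-- The exponent `f(τ)` of the sign that the transposition on `B` gives to a monomial. -/
def transposeExponent (nA nB : ℕ) (τ : Fin (2 * (nA + nB)) → Fin 2) : ℕ :=
  if degreeB nA nB τ % 4 = 0 ∨ degreeB nA nB τ % 4 = 1 then 0 else 1

/-- The partial transpose
`ρ^{T_B} = ∑_τ w_τ (-1)^{f(τ)} m_1^{τ_1} ⋯ m_{2k}^{τ_{2k}}`. -/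
def partialTranspose (nA nB : ℕ) (ρ : FockOp (nA + nB)) : FockOp (nA + nB) :=
  ∑ τ : Fin (2 * (nA + nB)) → Fin 2,
    (coeff ρ τ * (-1) ^ transposeExponent nA nB τ) • monomial τ

/-- The trace norm `‖X‖₁ = tr √(X† X)`, the sum of the singular values of `X`. -/
def traceNorm {k : ℕ} (X : FockOp k) : ℝ :=
  ∑ i, Real.sqrt ((Matrix.isHermitian_conjTranspose_mul_self X).eigenvalues i)

/-- The entanglement negativity `(‖ρ^{T_B}‖₁ - 1) / 2`. -/
def negativity (nA nB : ℕ) (ρ : FockOp (nA + nB)) : ℝ :=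
  (traceNorm (partialTranspose nA nB ρ) - 1) / 2

/-- The reduced covariance matrix `γ_A`, the restriction of `γ` to the Majorana operators of the
first `nA` modes. -/
def reducedCovariance (nA nB : ℕ) (ρ : FockOp (nA + nB)) :
    Matrix (Fin (2 * nA)) (Fin (2 * nA)) ℝ :=
  (covariance ρ).submatrix (Fin.castLE (by omega)) (Fin.castLE (by omega))

/-- `{± i a_j}` is the spectrum of the real `2n × 2n` matrix `M`, counted with (algebraic)
multiplicity over the complex numbers. -/
def HasSpectrum {n : ℕ} (M : Matrix (Fin (2 * n)) (Fin (2 * n)) ℝ) (a : Fin n → ℝ) : Prop :=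
  (M.map (fun x : ℝ => (x : ℂ))).charpoly.roots =
    ∑ j : Fin n, {Complex.I * (a j : ℂ), -(Complex.I * (a j : ℂ))}

/-- The function `g(a) = 1 + √(1 - a²)`. -/
def g (a : ℝ) : ℝ := 1 + Real.sqrt (1 - a ^ 2)

end FermionicNegativity

end

open scoped Matrix ComplexOrder

noncomputable section

namespace FermionicNegativity

/-! ### The Majorana operators as monomial matrices -/

/-! The negativity of a pure state depends only on the spectrum of the reduced state of `A`, and for
a Gaussian state that spectrum is fixed by the covariance matrix.

Jordan-Wigner identifies the Fock space with the tensor product of those of `A` and `B`. Transposing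
a product of Majorana operators reverses it and changes signs of factors; a suitable monomial `V` on
`B` undoes the latter by conjugation, and the reversal gives exactly the sign `(-1)^f(τ)`. Hence the
fermionic partial transpose is the ordinary one up to the unitary `1 ⊗ V`
(`tensorIso_partialTranspose`). If `ψ` has coefficient matrix `C` and `X` is the ordinary partial
transpose of `|ψ⟩⟨ψ|`, then `Xᴴ X = C Cᴴ ⊗ Cᴴ C` (`transposeSnd_pure`), so the trace norm is `(tr
√(C Cᴴ))²`.

The operator `C Cᴴ` has the moments of `ρ` on `A`, so it satisfies Wick's formula with `γ_A`. An
orthogonal change of basis brings `γ_A` to blocks `[[0, a_j], [-a_j, 0]]`. With `Q_j` the parity of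
the `j`-th rotated mode, the product of the `(1 + a_j Q_j)/2` satisfies a linear commutation
relation (`IsThermal`); together with cyclicity of the trace this yields the recursion of the sum
over pairings (`IsThermal.trace_eq_wickSum`). All moments agree, so this product is `C Cᴴ`. Its
square root is again a product over modes, and the square of its trace is `∏ g(a_j)`
(`gaussian_spectrum`). -/

lemma symmDiff_singleton_of_mem {α : Type*} [DecidableEq α] {T : Finset α} {j : α} (h : j ∈ T) :
    symmDiff T {j} = T.erase j := by
  ext x
  by_cases hx : x = j <;> simp [Finset.mem_symmDiff, hx, h]

lemma symmDiff_singleton_of_notMem {α : Type*} [DecidableEq α] {T : Finset α} {j : α}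
    (h : j ∉ T) : symmDiff T {j} = insert j T := by
  ext x
  by_cases hx : x = j <;> simp [Finset.mem_symmDiff, hx, h]

lemma eq_symmDiff_comm {α : Type*} [DecidableEq α] {S T U : Finset α} :
    S = symmDiff T U ↔ T = symmDiff S U := by
  constructor <;> rintro rfl <;> simp

/-- The Jordan-Wigner sign `(-1)^{#{i ∈ T : i < j}}`. -/
def jwSign {k : ℕ} (j : Fin k) (T : Finset (Fin k)) : ℂ :=
  (-1) ^ (T.filter (fun i => i < j)).card

/-- Toggling mode `i` changes the number of occupied modes below `j` by one if `i < j` and not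
otherwise. This asymmetry makes Majorana operators of different modes anticommute. -/
lemma jwSign_symmDiff {k : ℕ} (j i : Fin k) (T : Finset (Fin k)) :
    jwSign j (symmDiff T {i}) = (if i < j then -1 else 1) * jwSign j T := by
  unfold jwSign
  by_cases hT : i ∈ T
  · rw [symmDiff_singleton_of_mem hT]
    split_ifs with hij
    · have hm : i ∈ T.filter (fun x => x < j) := by simp [hT, hij]
      have hc := Finset.card_erase_add_one hm
      rw [← Finset.filter_erase] at hc
      rw [← hc, pow_succ]
      ring
    · have : (T.erase i).filter (fun x => x < j) = T.filter (fun x => x < j) := by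
        ext x
        simp only [Finset.mem_filter, Finset.mem_erase]
        grind
      rw [this, one_mul]
  · rw [symmDiff_singleton_of_notMem hT, Finset.filter_insert]
    split_ifs with hij
    · rw [Finset.card_insert_of_notMem (by simp [hT]), pow_succ]
      ring
    · simp

lemma jwSign_mul_self {k : ℕ} (j : Fin k) (T : Finset (Fin k)) : jwSign j T * jwSign j T = 1 := by
  unfold jwSign
  rw [← mul_pow]
  simp

/-- The phase by which a Majorana operator of mode `j` acts, apart from the Jordan-Wigner sign. -/
def localPhase {k : ℕ} (a : Fin (2 * k)) (T : Finset (Fin k)) : ℂ :=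
  if (a : ℕ) % 2 = 0 then 1 else if modeOf a ∈ T then -Complex.I else Complex.I

lemma annihilation_apply {k : ℕ} (j : Fin k) (S T : Finset (Fin k)) :
    annihilation j S T = if S = symmDiff T {j} then (if j ∈ T then jwSign j T else 0) else 0 := by
  unfold annihilation jwSign
  by_cases hT : j ∈ T
  · simp [hT, symmDiff_singleton_of_mem]
  · simp [hT]

lemma creation_apply {k : ℕ} (j : Fin k) (S T : Finset (Fin k)) :
    creation j S T = if S = symmDiff T {j} then (if j ∈ T then 0 else jwSign j T) else 0 := by
  rw [creation, Matrix.conjTranspose_apply, annihilation_apply]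
  simp only [eq_symmDiff_comm (S := T)]
  by_cases h : S = symmDiff T {j}
  · subst h
    simp only [Finset.mem_symmDiff, Finset.mem_singleton, jwSign_symmDiff]
    by_cases hT : j ∈ T <;> simp [hT, ← starRingEnd_apply, jwSign]
  · simp [h]

/-- Each Majorana operator toggles one mode and multiplies by a phase, so the Clifford relations
reduce to a comparison of phases. -/
lemma majorana_apply {k : ℕ} (a : Fin (2 * k)) (S T : Finset (Fin k)) :
    majorana a S T =
      if S = symmDiff T {modeOf a} then localPhase a T * jwSign (modeOf a) T else 0 := by
  unfold majorana localPhase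
  split_ifs <;> simp_all [annihilation_apply, creation_apply]
  split_ifs <;> simp

lemma majorana_mul_apply {k : ℕ} (a b : Fin (2 * k)) (S T : Finset (Fin k)) :
    (majorana a * majorana b) S T =
      if S = symmDiff (symmDiff T {modeOf b}) {modeOf a} then
        localPhase a (symmDiff T {modeOf b}) * jwSign (modeOf a) (symmDiff T {modeOf b}) *
          (localPhase b T * jwSign (modeOf b) T) else 0 := by
  simp only [Matrix.mul_apply, majorana_apply, mul_ite, ite_mul, zero_mul, mul_zero]
  rw [Finset.sum_ite_eq']
  simp

lemma localPhase_symmDiff_of_ne {k : ℕ} {a b : Fin (2 * k)} (h : modeOf a ≠ modeOf b)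
    (T : Finset (Fin k)) : localPhase a (symmDiff T {modeOf b}) = localPhase a T := by
  simp [localPhase, Finset.mem_symmDiff, h]

lemma majorana_mul_self {k : ℕ} (a : Fin (2 * k)) : majorana a * majorana a = 1 := by
  ext S T
  rw [majorana_mul_apply, Matrix.one_apply, symmDiff_assoc, symmDiff_self, symmDiff_bot,
    jwSign_symmDiff]
  simp only [lt_irrefl, if_false, one_mul]
  have h : localPhase a (symmDiff T {modeOf a}) * localPhase a T = 1 := by
    unfold localPhase
    by_cases ha : (a : ℕ) % 2 = 0 <;> by_cases hT : modeOf a ∈ T <;>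
      simp [Finset.mem_symmDiff, hT, ha]
  split_ifs
  · linear_combination (jwSign (modeOf a) T * jwSign (modeOf a) T) * h + jwSign_mul_self (modeOf a) T
  · rfl

lemma majorana_anticomm {k : ℕ} {a b : Fin (2 * k)} (hab : a ≠ b) :
    majorana a * majorana b = -(majorana b * majorana a) := by
  ext S T
  rw [Matrix.neg_apply, majorana_mul_apply, majorana_mul_apply,
    symmDiff_assoc, symmDiff_assoc, symmDiff_comm {modeOf b}]
  split_ifs with h
  · by_cases hm : modeOf a = modeOf b
    · simp only [hm, jwSign_symmDiff, lt_irrefl, if_false, one_mul]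
      have hm' : (a : ℕ) / 2 = b / 2 := by simpa [modeOf] using hm
      have hne : (a : ℕ) ≠ b := fun h => hab (Fin.ext h)
      have key : localPhase a (symmDiff T {modeOf b}) * localPhase b T =
          -(localPhase b (symmDiff T {modeOf b}) * localPhase a T) := by
        unfold localPhase
        rw [hm]
        rcases Nat.mod_two_eq_zero_or_one a with ha | ha <;>
        rcases Nat.mod_two_eq_zero_or_one b with hb | hb
        · omega
        · by_cases hT : modeOf b ∈ T <;> simp [Finset.mem_symmDiff, hT, ha, hb]
        · by_cases hT : modeOf b ∈ T <;> simp [Finset.mem_symmDiff, hT, ha, hb]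
        · omega
      linear_combination (jwSign (modeOf b) T * jwSign (modeOf b) T) * key
    · rw [localPhase_symmDiff_of_ne hm, localPhase_symmDiff_of_ne (Ne.symm hm), jwSign_symmDiff,
        jwSign_symmDiff]
      rcases lt_or_gt_of_ne hm with hlt | hlt
      · rw [if_neg (not_lt.2 hlt.le), if_pos hlt]
        ring
      · rw [if_neg (not_lt.2 hlt.le), if_pos hlt]
        ring
  · simp

lemma majorana_conjTranspose {k : ℕ} (a : Fin (2 * k)) : (majorana a)ᴴ = majorana a := by
  unfold majorana creation
  split_ifs
  · simp [add_comm]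
  · simp [← smul_neg]

/-- The matrix of `f_j` is real, so transposition exchanges `f_j` and `f_j†`: their sum is
symmetric, their difference antisymmetric. -/
lemma majorana_transpose {k : ℕ} (a : Fin (2 * k)) :
    (majorana a)ᵀ = (-1 : ℂ) ^ (a : ℕ) • majorana a := by
  have hconj : ∀ j : Fin k, (annihilation j)ᴴ = (annihilation j)ᵀ := by
    intro j
    ext S T
    simp [annihilation_apply, apply_ite (starRingEnd ℂ), jwSign]
  unfold majorana creation
  rw [hconj]
  split_ifs with h
  · rw [(Nat.even_iff.2 h).neg_one_pow]
    simp [add_comm]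
  · rw [(Nat.odd_iff.2 (by omega)).neg_one_pow]
    simp [← smul_neg]

/-! ### Ordered monomials in anticommuting elements -/

section Clifford

/-- The ordered monomial `c_1^{τ_1} ⋯ c_N^{τ_N}`. -/
def orderedMonomial {A : Type*} [Monoid A] {N : ℕ} (c : Fin N → A) (τ : Fin N → Fin 2) : A :=
  (List.ofFn fun i => c i ^ (τ i : ℕ)).prod

lemma orderedMonomial_succ {A : Type*} [Monoid A] {N : ℕ} (c : Fin (N + 1) → A) (τ : Fin (N + 1) → Fin 2) :
    orderedMonomial c τ =
      c 0 ^ (τ 0 : ℕ) * orderedMonomial (fun i => c i.succ) (fun i => τ i.succ) := by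
  simp [orderedMonomial, List.ofFn_succ]

lemma fin_two_cases (t : Fin 2) : t = 0 ∨ t = 1 := by
  omega

variable {A : Type*} [Ring A] [Algebra ℂ A]

lemma mul_orderedMonomial {N : ℕ} (c : Fin N → A) (τ : Fin N → Fin 2) (x : A) (s : Fin N → ℂ)
    (h : ∀ i, x * c i = s i • (c i * x)) :
    x * orderedMonomial c τ = (∏ i, s i ^ (τ i : ℕ)) • (orderedMonomial c τ * x) := by
  induction N with
  | zero => simp [orderedMonomial]
  | succ N ih =>
    rw [orderedMonomial_succ, Fin.prod_univ_succ]
    have ih' := ih (fun i => c i.succ) (fun i => τ i.succ) (fun i => s i.succ)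
      (fun i => h i.succ)
    set M := orderedMonomial (fun i => c i.succ) (fun i => τ i.succ)
    have h0 : x * c 0 ^ (τ 0 : ℕ) = s 0 ^ (τ 0 : ℕ) • (c 0 ^ (τ 0 : ℕ) * x) := by
      rcases fin_two_cases (τ 0) with ht | ht <;> simp [ht, h 0]
    rw [← mul_assoc, h0, smul_mul_assoc, mul_assoc, ih', mul_smul_comm, smul_smul, mul_assoc]

/-- Reversing `d` anticommuting factors takes `d.choose 2` transpositions; the induction moves the
first factor past the rest and uses Pascal's rule. -/
lemma reverse_orderedMonomial {N : ℕ} (c : Fin N → A) (τ : Fin N → Fin 2)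
    (h : ∀ i j, i ≠ j → c i * c j = -(c j * c i)) :
    (List.ofFn fun i => c i ^ (τ i : ℕ)).reverse.prod =
      ((-1 : ℂ) ^ ((∑ i, (τ i : ℕ)).choose 2)) • orderedMonomial c τ := by
  induction N with
  | zero => simp [orderedMonomial]
  | succ N ih =>
    rw [orderedMonomial_succ, Fin.sum_univ_succ, List.ofFn_succ, List.reverse_cons,
      List.prod_append, List.prod_singleton,
      ih (fun i => c i.succ) (fun i => τ i.succ) (fun i j hij => h _ _ (by simpa using hij))]
    have hc := mul_orderedMonomial (fun i => c i.succ) (fun i => τ i.succ) (c 0) (fun _ => -1)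
      (fun i => by rw [h 0 i.succ (Fin.succ_ne_zero i).symm]; simp)
    rw [Finset.prod_pow_eq_pow_sum] at hc
    rcases fin_two_cases (τ 0) with ht | ht
    · simp [ht]
    · simp only [ht, Fin.val_one, pow_one]
      rw [hc, add_comm 1, Nat.choose_succ_succ' _ 1, Nat.choose_one_right, smul_mul_assoc,
        smul_smul]
      congr 1
      rw [pow_add, mul_right_comm, ← pow_add, ← two_mul]
      simp

/-- Every factor other than `c j` itself contributes a sign, so the exponent is the degree minus `τ
j`; modulo two this is the sum. -/
lemma mul_orderedMonomial_anticomm {N : ℕ} (c : Fin N → A) (τ : Fin N → Fin 2)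
    (h : ∀ i j, i ≠ j → c i * c j = -(c j * c i)) (j : Fin N) :
    c j * orderedMonomial c τ =
      ((-1 : ℂ) ^ ((∑ i, (τ i : ℕ)) + τ j)) • (orderedMonomial c τ * c j) := by
  rw [mul_orderedMonomial c τ (c j) (fun i => if i = j then 1 else -1)]
  · congr 1
    have : ∀ i, (if i = j then (1 : ℂ) else -1) ^ (τ i : ℕ) =
        (-1) ^ (τ i : ℕ) * (if i = j then (-1) ^ (τ j : ℕ) else 1) := by
      intro i
      split_ifs with hi
      · rw [hi, ← mul_pow]
        simp
      · simp
    rw [Finset.prod_congr rfl fun i _ => this i, Finset.prod_mul_distrib,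
      Finset.prod_pow_eq_pow_sum, Finset.prod_ite_eq' Finset.univ j, if_pos (Finset.mem_univ j),
      pow_add]
  · intro i
    split_ifs with hi
    · simp [hi]
    · rw [h j i (Ne.symm hi)]
      simp

end Clifford

lemma list_reverse_prod_mul_prod {M : Type*} [Monoid M] (L : List M) (h : ∀ x ∈ L, x * x = 1) :
    L.reverse.prod * L.prod = 1 := by
  induction L with
  | nil => simp
  | cons a L ih =>
    have h1 := h a (by simp)
    have h2 := ih fun x hx => h x (by simp [hx])
    simp only [List.reverse_cons, List.prod_append, List.prod_cons, List.prod_nil, mul_one]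
    rw [mul_assoc, ← mul_assoc a, h1, one_mul, h2]

/-! ### The Majorana monomials form an orthogonal basis -/

lemma monomial_eq_orderedMonomial {k : ℕ} (τ : Fin (2 * k) → Fin 2) :
    monomial τ = orderedMonomial majorana τ := rfl

lemma majorana_mul_monomial {k : ℕ} (τ : Fin (2 * k) → Fin 2) (j : Fin (2 * k)) :
    majorana j * monomial τ =
      ((-1 : ℂ) ^ ((∑ i, (τ i : ℕ)) + τ j)) • (monomial τ * majorana j) :=
  mul_orderedMonomial_anticomm majorana τ (fun _ _ => majorana_anticomm) j

lemma monomial_conjTranspose {k : ℕ} (τ : Fin (2 * k) → Fin 2) :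
    (monomial τ)ᴴ = (List.ofFn fun i => majorana i ^ (τ i : ℕ)).reverse.prod := by
  rw [monomial, Matrix.conjTranspose_list_prod, List.map_ofFn]
  congr 3
  ext1 i
  simp [Matrix.conjTranspose_pow, majorana_conjTranspose]

lemma monomial_conjTranspose_mul_self {k : ℕ} (τ : Fin (2 * k) → Fin 2) :
    (monomial τ)ᴴ * monomial τ = 1 := by
  rw [monomial_conjTranspose]
  refine list_reverse_prod_mul_prod _ fun x hx => ?_
  obtain ⟨i, rfl⟩ := (List.mem_ofFn' _ _).1 hx
  rw [← pow_add, ← two_mul, pow_mul, sq, majorana_mul_self, one_pow]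

lemma monomial_mul_conjTranspose_self {k : ℕ} (τ : Fin (2 * k) → Fin 2) :
    monomial τ * (monomial τ)ᴴ = 1 :=
  mul_eq_one_comm.1 (monomial_conjTranspose_mul_self τ)

lemma trace_eq_zero_of_anticomm {ι : Type*} [Fintype ι] [DecidableEq ι] {X m : Matrix ι ι ℂ}
    (hm : m * m = 1) (h : m * X = -(X * m)) : X.trace = 0 := by
  have h1 : (m * X * m).trace = X.trace := by
    rw [Matrix.trace_mul_comm, ← mul_assoc, hm, one_mul]
  rw [h, neg_mul, mul_assoc, hm, mul_one, Matrix.trace_neg] at h1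
  linear_combination (-1 / 2 : ℂ) * h1

/-- Some Majorana operator commutes with one monomial and anticommutes with the other. Otherwise
degrees of equal parity would force `τ = τ'`, and degrees of different parity would force
complementary bit strings, whose degrees add up to the even number `2 * k`. -/
lemma exists_odd_index {k : ℕ} {τ τ' : Fin (2 * k) → Fin 2} (h : τ ≠ τ') :
    ∃ j, Odd (((∑ i, (τ i : ℕ)) + τ j) + ((∑ i, (τ' i : ℕ)) + τ' j)) := by
  by_contra hcon
  simp only [not_exists, Nat.not_odd_iff_even] at hcon
  rcases Nat.even_or_odd ((∑ i, (τ i : ℕ)) + (∑ i, (τ' i : ℕ))) with he | ho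
  · apply h
    ext j
    have := hcon j
    grind
  · have hone : ∀ j, (τ j : ℕ) + τ' j = 1 := by
      intro j
      have := hcon j
      grind
    rw [← Finset.sum_add_distrib, Finset.sum_congr rfl fun j _ => hone j] at ho
    simp at ho
    exact Nat.not_odd_iff_even.2 (even_two_mul k) ho

lemma trace_monomial_conjTranspose_mul {k : ℕ} (τ τ' : Fin (2 * k) → Fin 2) :
    ((monomial τ)ᴴ * monomial τ').trace = if τ = τ' then 2 ^ k else 0 := by
  split_ifs with h
  · subst h
    rw [monomial_conjTranspose_mul_self, Matrix.trace_one]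
    simp
  · obtain ⟨j, hj⟩ := exists_odd_index h
    refine trace_eq_zero_of_anticomm (majorana_mul_self j) ?_
    have h1 := congrArg Matrix.conjTranspose (majorana_mul_monomial τ j)
    rw [Matrix.conjTranspose_mul, Matrix.conjTranspose_smul, Matrix.conjTranspose_mul,
      majorana_conjTranspose, star_pow, star_neg, star_one] at h1
    have h2 : majorana j * (monomial τ)ᴴ =
        ((-1 : ℂ) ^ ((∑ i, (τ i : ℕ)) + τ j)) • ((monomial τ)ᴴ * majorana j) := by
      rw [h1, smul_smul, ← mul_pow]
      simp
    rw [← mul_assoc, h2, smul_mul_assoc, mul_assoc, majorana_mul_monomial, mul_smul_comm,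
      smul_smul, ← pow_add, hj.neg_one_pow, neg_one_smul, mul_assoc]

lemma coeff_sum_monomial {k : ℕ} (w : (Fin (2 * k) → Fin 2) → ℂ) (τ : Fin (2 * k) → Fin 2) :
    coeff (∑ τ', w τ' • monomial τ') τ = w τ := by
  simp [coeff, Finset.mul_sum, Matrix.trace_sum, Matrix.trace_smul,
    trace_monomial_conjTranspose_mul]

/-- Orthogonality gives linear independence, and there are `2 ^ (2 * k)` monomials, the dimension of
the operator space. -/
lemma sum_coeff_smul_monomial {k : ℕ} (X : FockOp k) :
    ∑ τ, coeff X τ • monomial τ = X := by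
  have hli : LinearIndependent ℂ (monomial : (Fin (2 * k) → Fin 2) → FockOp k) := by
    rw [Fintype.linearIndependent_iff]
    intro w hw τ
    rw [← coeff_sum_monomial w τ, hw]
    simp [coeff]
  have hspan := hli.span_eq_top_of_card_eq_finrank' (by
    simp [Module.finrank_matrix, two_mul, pow_add])
  have hX : X ∈ Submodule.span ℂ (Set.range (monomial : (Fin (2 * k) → Fin 2) → FockOp k)) := by
    rw [hspan]
    trivial
  obtain ⟨w, rfl⟩ := (Submodule.mem_span_range_iff_exists_fun ℂ).1 hX
  simp only [coeff_sum_monomial]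

/-- Operators with the same expectation values of all monomials agree. -/
lemma eq_of_trace_mul_monomial {k : ℕ} {X Y : FockOp k}
    (h : ∀ τ, (X * monomial τ).trace = (Y * monomial τ).trace) : X = Y := by
  rw [← sub_eq_zero, ← Matrix.trace_conjTranspose_mul_self_eq_zero_iff, Matrix.trace_mul_comm]
  conv_lhs => rw [← sum_coeff_smul_monomial (X - Y)ᴴ]
  rw [Finset.mul_sum, Matrix.trace_sum]
  refine Finset.sum_eq_zero fun τ _ => ?_
  rw [mul_smul_comm, Matrix.trace_smul, sub_mul, Matrix.trace_sub, h, sub_self, smul_zero]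

/-- A monomial is the product of the Majorana operators in its support. -/
lemma exists_orderedMonomial_eq {A : Type*} [Ring A] [Algebra ℂ A] {N : ℕ} (c : Fin N → A)
    (τ : Fin N → Fin 2) : ∃ (q : ℕ) (j : Fin q → Fin N), Function.Injective j ∧
      orderedMonomial c τ = (List.ofFn fun i => c (j i)).prod := by
  induction N with
  | zero => exact ⟨0, Fin.elim0, fun i => i.elim0, by simp [orderedMonomial]⟩
  | succ N ih =>
    obtain ⟨q, j, hj, h⟩ := ih (fun i => c i.succ) (fun i => τ i.succ)
    rw [orderedMonomial_succ, h]
    rcases fin_two_cases (τ 0) with ht | ht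
    · exact ⟨q, fun i => (j i).succ, (Fin.succ_injective N).comp hj, by simp [ht]⟩
    · refine ⟨q + 1, Fin.cons 0 fun i => (j i).succ, ?_, by simp [ht, List.ofFn_succ]⟩
      rw [Fin.cons_injective_iff]
      exact ⟨by simp [Set.mem_range, Fin.succ_ne_zero], (Fin.succ_injective N).comp hj⟩

lemma parity_eq_monomial (k : ℕ) : parity k = monomial fun _ => 1 := by
  simp [parity, monomial]

lemma majorana_mul_parity {k : ℕ} (j : Fin (2 * k)) :
    majorana j * parity k = -(parity k * majorana j) := by
  rw [parity_eq_monomial, majorana_mul_monomial]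
  simp [pow_add, pow_mul]

lemma parity_mul_list_prod {k : ℕ} (L : List (FockOp k))
    (h : ∀ x ∈ L, parity k * x = -(x * parity k)) :
    parity k * L.prod = (-1 : ℂ) ^ L.length • (L.prod * parity k) := by
  induction L with
  | nil => simp
  | cons a L ih =>
    rw [List.prod_cons, ← mul_assoc, h a (by simp), neg_mul, mul_assoc,
      ih fun x hx => h x (by simp [hx]), List.length_cons, pow_succ]
    simp [mul_assoc]

lemma parity_mul_majoranaProd {k q : ℕ} (j : Fin q → Fin (2 * k)) :
    parity k * majoranaProd j = (-1 : ℂ) ^ q • (majoranaProd j * parity k) := by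
  rw [majoranaProd, parity_mul_list_prod, List.length_ofFn]
  intro x hx
  obtain ⟨i, rfl⟩ := (List.mem_ofFn' _ _).1 hx
  rw [majorana_mul_parity, neg_neg]

lemma parity_conjTranspose_mul_self (k : ℕ) : (parity k)ᴴ * parity k = 1 := by
  rw [parity_eq_monomial, monomial_conjTranspose_mul_self]

/-- Odd moments of an operator commuting with the parity vanish. -/
lemma trace_mul_majoranaProd_of_odd {k q : ℕ} {ρ : FockOp k} (hρ : Commute ρ (parity k))
    (hq : Odd q) (j : Fin q → Fin (2 * k)) : (ρ * majoranaProd j).trace = 0 := by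
  have h1 : ((ρ * majoranaProd j) * parity k * (parity k)ᴴ).trace =
      (ρ * majoranaProd j).trace := by
    rw [mul_assoc _ (parity k), mul_eq_one_comm.1 (parity_conjTranspose_mul_self k), mul_one]
  have h2 : ρ * majoranaProd j * parity k = -(parity k * (ρ * majoranaProd j)) := by
    have := parity_mul_majoranaProd j
    rw [hq.neg_one_pow, neg_one_smul] at this
    rw [← mul_assoc, ← hρ.eq, mul_assoc, mul_assoc, this, mul_neg, neg_neg]
  rw [h2, Matrix.trace_mul_comm, mul_neg, ← mul_assoc, parity_conjTranspose_mul_self, one_mul,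
    Matrix.trace_neg] at h1
  linear_combination (-1 / 2 : ℂ) * h1

/-! ### Expansion of the sum over pairings along the first element -/

/-- The permutation sending `0 ↦ r` and permuting the remaining elements by `σ`. -/
def insertPerm {N : ℕ} (r : Fin (N + 1)) (σ : Equiv.Perm (Fin N)) : Equiv.Perm (Fin (N + 1)) :=
  r.cycleRange.symm * Equiv.Perm.decomposeFin.symm (0, σ)

lemma insertPerm_zero {N : ℕ} (r : Fin (N + 1)) (σ : Equiv.Perm (Fin N)) :
    insertPerm r σ 0 = r := by
  simp [insertPerm]

lemma insertPerm_succ {N : ℕ} (r : Fin (N + 1)) (σ : Equiv.Perm (Fin N)) (i : Fin N) :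
    insertPerm r σ i.succ = r.succAbove (σ i) := by
  simp [insertPerm]

lemma sign_insertPerm {N : ℕ} (r : Fin (N + 1)) (σ : Equiv.Perm (Fin N)) :
    Equiv.Perm.sign (insertPerm r σ) = (-1) ^ (r : ℕ) * Equiv.Perm.sign σ := by
  simp [insertPerm, Equiv.Perm.decomposeFin.symm_sign, Fin.sign_cycleRange, ← Equiv.Perm.inv_def]

lemma exists_eq_insertPerm {N : ℕ} (π : Equiv.Perm (Fin (N + 1))) :
    ∃ σ, π = insertPerm (π 0) σ := by
  obtain ⟨⟨p, σ⟩, h⟩ := Equiv.Perm.decomposeFin.symm.surjective ((π 0).cycleRange * π)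
  have hp : p = 0 := by
    have := congrArg (fun f : Equiv.Perm (Fin (N + 1)) => f 0) h
    simpa using this
  subst hp
  refine ⟨σ, ?_⟩
  rw [insertPerm, h, ← mul_assoc, ← Equiv.Perm.inv_def, inv_mul_cancel, one_mul]

lemma insertPerm_injective {N : ℕ} {r r' : Fin (N + 1)} {σ σ' : Equiv.Perm (Fin N)}
    (h : insertPerm r σ = insertPerm r' σ') : r = r' ∧ σ = σ' := by
  have hr : r = r' := by rw [← insertPerm_zero r σ, h, insertPerm_zero]
  subst hr
  refine ⟨rfl, Equiv.ext fun i => ?_⟩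
  apply Fin.succAbove_right_injective (p := r)
  rw [← insertPerm_succ, h, insertPerm_succ]

/-- The pairing matching the first element with the one at position `r` of the others, and
pairing the rest by `σ`. -/
def insertPair {p : ℕ} (r : Fin (2 * p + 1)) (σ : Equiv.Perm (Fin (2 * p))) :
    Equiv.Perm (Fin (2 * (p + 1))) :=
  insertPerm (N := 2 * p + 1) 0 (insertPerm r σ)

lemma insertPair_fst_zero {p : ℕ} (r : Fin (2 * p + 1)) (σ : Equiv.Perm (Fin (2 * p))) :
    insertPair r σ (fstIdx 0) = 0 :=
  insertPerm_zero _ _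

lemma insertPair_snd_zero {p : ℕ} (r : Fin (2 * p + 1)) (σ : Equiv.Perm (Fin (2 * p))) :
    insertPair r σ (sndIdx 0) = Fin.succ (n := 2 * p + 1) r := by
  have : (sndIdx 0 : Fin (2 * (p + 1))) = Fin.succ (n := 2 * p + 1) 0 := by ext; simp [sndIdx]
  rw [this, insertPair, insertPerm_succ, insertPerm_zero]
  simp

lemma insertPair_fst_succ {p : ℕ} (r : Fin (2 * p + 1)) (σ : Equiv.Perm (Fin (2 * p)))
    (l : Fin p) : insertPair r σ (fstIdx l.succ) =
      Fin.succ (n := 2 * p + 1) (r.succAbove (σ (fstIdx l))) := by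
  have : (fstIdx l.succ : Fin (2 * (p + 1))) =
      Fin.succ (n := 2 * p + 1) (Fin.succ (fstIdx l)) := by
    ext; simp [fstIdx]; ring
  rw [this, insertPair, insertPerm_succ, insertPerm_succ]
  simp

lemma insertPair_snd_succ {p : ℕ} (r : Fin (2 * p + 1)) (σ : Equiv.Perm (Fin (2 * p)))
    (l : Fin p) : insertPair r σ (sndIdx l.succ) =
      Fin.succ (n := 2 * p + 1) (r.succAbove (σ (sndIdx l))) := by
  have : (sndIdx l.succ : Fin (2 * (p + 1))) =
      Fin.succ (n := 2 * p + 1) (Fin.succ (sndIdx l)) := by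
    ext; simp [sndIdx]; ring
  rw [this, insertPair, insertPerm_succ, insertPerm_succ]
  simp

/-- Relabelling by `succ` and `succAbove` is strictly increasing, so the order conditions on the
remaining pairs are unchanged; those involving the first pair hold because it starts with `0`. -/
lemma isPairing_insertPair {p : ℕ} (r : Fin (2 * p + 1)) (σ : Equiv.Perm (Fin (2 * p))) :
    IsPairing (insertPair r σ) ↔ IsPairing σ := by
  unfold IsPairing
  simp only [Fin.forall_fin_succ, insertPair_fst_zero, insertPair_snd_zero, insertPair_fst_succ,
    insertPair_snd_succ, Fin.succ_lt_succ_iff, Fin.succAbove_lt_succAbove_iff]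
  have hpos : ∀ x : Fin (2 * p + 1), (0 : Fin (2 * (p + 1))) < Fin.succ (n := 2 * p + 1) x :=
    fun x => Fin.succ_pos x
  simp [hpos]

/-- The least element cannot be second in its pair, and since first elements increase it must open
the first pair. -/
lemma IsPairing.apply_zero {p : ℕ} {π : Equiv.Perm (Fin (2 * (p + 1)))} (h : IsPairing π) :
    π 0 = 0 := by
  obtain ⟨i, hi⟩ := π.surjective 0
  have hfst : ∀ l : Fin (p + 1), π (fstIdx l) = 0 → l = 0 := by
    intro l hl
    by_contra hne
    exact absurd (h.2 0 l (Fin.pos_of_ne_zero hne)) (by rw [hl]; exact Fin.not_lt_zero _)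
  have hl : (i : ℕ) / 2 < p + 1 := by omega
  rcases Nat.mod_two_eq_zero_or_one i with hm | hm
  · have he : i = fstIdx ⟨(i : ℕ) / 2, hl⟩ := by ext; simp only [fstIdx]; omega
    have h0 := hfst _ (he ▸ hi)
    rw [h0] at he
    rwa [he] at hi
  · have he : i = sndIdx ⟨(i : ℕ) / 2, hl⟩ := by ext; simp only [sndIdx]; omega
    have hlt := h.1 ⟨(i : ℕ) / 2, hl⟩
    rw [← he, hi] at hlt
    exact absurd hlt (Fin.not_lt_zero _)

lemma wickSum_zero {k : ℕ} (γ : Matrix (Fin (2 * k)) (Fin (2 * k)) ℝ)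
    (j : Fin (2 * 0) → Fin (2 * k)) : wickSum γ j = 1 := by
  classical
  unfold wickSum
  have : ∀ π : Equiv.Perm (Fin (2 * 0)), IsPairing π := fun π =>
    ⟨fun l => l.elim0, fun l => l.elim0⟩
  rw [Finset.filter_true_of_mem fun π _ => this π]
  have hu : (Finset.univ : Finset (Equiv.Perm (Fin (2 * 0)))) = {1} := by
    ext π
    simp only [Finset.mem_univ, Finset.mem_singleton, true_iff]
    exact Equiv.ext fun i => i.elim0
  rw [hu]
  simp

/-- Expansion of the sum over pairings along the first element. -/
lemma wickSum_succ {k p : ℕ} (γ : Matrix (Fin (2 * k)) (Fin (2 * k)) ℝ)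
    (j0 : Fin (2 * k)) (j : Fin (2 * p + 1) → Fin (2 * k)) :
    wickSum (p := p + 1) γ (Fin.cons (α := fun _ => Fin (2 * k)) (n := 2 * p + 1) j0 j) =
      ∑ r : Fin (2 * p + 1), (-1) ^ (r : ℕ) * γ j0 (j r) *
        wickSum γ (fun i => j (r.succAbove i)) := by
  classical
  unfold wickSum
  simp only [Finset.mul_sum]
  rw [← Finset.sum_product' (f := fun (r : Fin (2 * p + 1)) (σ : Equiv.Perm (Fin (2 * p))) => (-1) ^ (r : ℕ) * γ j0 (j r) *
      ((((Equiv.Perm.sign σ : ℤˣ) : ℤ) : ℝ) *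
        ∏ l, γ (j (r.succAbove (σ (fstIdx l)))) (j (r.succAbove (σ (sndIdx l))))))]
  symm
  -- A pairing amounts to the partner of the first element together with a pairing of the rest.
  refine Finset.sum_nbij (fun x => insertPair x.1 x.2) ?_ ?_ ?_ ?_
  · rintro ⟨r, σ⟩ h
    simp only [Finset.mem_product, Finset.mem_univ, Finset.mem_filter, true_and] at h ⊢
    exact (isPairing_insertPair r σ).2 h
  · rintro ⟨r, σ⟩ _ ⟨r', σ'⟩ _ h
    obtain ⟨h1, h2⟩ := insertPerm_injective (insertPerm_injective h).2
    exact Prod.ext h1 h2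
  · intro π h
    simp only [Finset.coe_filter, Finset.mem_univ, true_and, Set.mem_ofPred_eq] at h
    obtain ⟨τ, hτ⟩ := exists_eq_insertPerm (N := 2 * p + 1) π
    have h0 : π (0 : Fin (2 * p + 1 + 1)) = 0 := h.apply_zero
    rw [h0] at hτ
    obtain ⟨σ, hσ⟩ := exists_eq_insertPerm τ
    have hπ : π = insertPair (τ 0) σ := by rw [insertPair, ← hσ, hτ]
    refine ⟨⟨τ 0, σ⟩, ?_, hπ.symm⟩
    simp only [Finset.coe_product, Set.mem_prod, Finset.mem_coe, Finset.mem_univ,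
      Finset.mem_filter, true_and]
    rw [hπ] at h
    exact (isPairing_insertPair _ _).1 h
  · rintro ⟨r, σ⟩ _
    have hs : Equiv.Perm.sign (insertPair r σ) = (-1) ^ (r : ℕ) * Equiv.Perm.sign σ := by
      rw [insertPair, sign_insertPerm, sign_insertPerm]
      simp
    rw [hs, Fin.prod_univ_succ]
    simp only [insertPair_fst_zero, insertPair_snd_zero, insertPair_fst_succ,
      insertPair_snd_succ, Fin.cons_succ]
    have hc0 : (Fin.cons (α := fun _ => Fin (2 * k)) (n := 2 * p + 1) j0 j :
      Fin (2 * p + 1 + 1) → Fin (2 * k)) (0 : Fin (2 * (p + 1))) = j0 := rfl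
    rw [hc0]
    push_cast
    ring

/-! ### Normal form of real skew-symmetric maps -/

open scoped InnerProductSpace

/-- The square of a skew map is symmetric, hence has an eigenbasis. If `u` is a unit eigenvector of
`T²` with `T u ≠ 0`, then `T u ⊥ u` and `T² u = -‖T u‖² u`, so `u` and `T u` span an invariant
plane. If `T = 0`, any orthonormal pair works. -/
lemma exists_skew_plane {E : Type*} [NormedAddCommGroup E] [InnerProductSpace ℝ E]
    [FiniteDimensional ℝ E] (hE : 2 ≤ Module.finrank ℝ E) (T : E →ₗ[ℝ] E)
    (hT : ∀ x y, ⟪T x, y⟫_ℝ = -⟪x, T y⟫_ℝ) :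
    ∃ (u v : E) (a : ℝ), ⟪u, u⟫_ℝ = 1 ∧ ⟪v, v⟫_ℝ = 1 ∧ ⟪u, v⟫_ℝ = 0 ∧
      T u = -a • v ∧ T v = a • u := by
  by_cases h0 : T = 0
  · let b := stdOrthonormalBasis ℝ E
    let i0 : Fin (Module.finrank ℝ E) := ⟨0, by omega⟩
    let i1 : Fin (Module.finrank ℝ E) := ⟨1, by omega⟩
    refine ⟨b i0, b i1, 0, ?_, ?_, ?_, by simp [h0], by simp [h0]⟩
    · simp
    · simp
    · rw [b.inner_eq_ite, if_neg (by simp [i0, i1])]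
  · have hS : (T * T).IsSymmetric := by
      intro x y
      simp only [Module.End.mul_apply]
      rw [hT, hT, neg_neg]
    let b := hS.eigenvectorBasis rfl
    obtain ⟨i, hi⟩ : ∃ i, T (b i) ≠ 0 := by
      by_contra hcon
      push Not at hcon
      exact h0 (b.toBasis.ext fun i => by simpa using hcon i)
    obtain ⟨μ, hμ⟩ : ∃ μ : ℝ, T (T (b i)) = μ • b i :=
      ⟨hS.eigenvalues rfl i, hS.apply_eigenvectorBasis rfl i⟩
    set u := b i with hu
    have huu : ⟪u, u⟫_ℝ = 1 := by simp [hu]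
    have hskew : ∀ x, ⟪x, T x⟫_ℝ = 0 := by
      intro x
      have := hT x x
      rw [real_inner_comm] at this
      linarith
    set a := ‖T u‖ with ha
    have ha0 : a ≠ 0 := norm_ne_zero_iff.2 hi
    have hTT : ⟪T u, T u⟫_ℝ = a * a := real_inner_self_eq_norm_mul_norm _
    have hμa : μ = -(a * a) := by
      have := hT u (T u)
      rw [hμ, inner_smul_right, huu, hTT] at this
      linarith
    refine ⟨u, -a⁻¹ • T u, a, huu, ?_, ?_, ?_, ?_⟩
    · rw [inner_smul_left, inner_smul_right, hTT]
      simp only [conj_trivial]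
      field_simp
    · rw [inner_smul_right, hskew, mul_zero]
    · rw [smul_smul]
      simp [ha0]
    · rw [map_smul, hμ, hμa, smul_smul]
      congr 1
      field_simp

/-- Skewness makes the orthogonal complement of an invariant plane invariant, so planes can be split
off one at a time. The space is quantified inside the induction because it shrinks to that
complement. -/
lemma exists_skew_normalForm (n : ℕ) : ∀ (E : Type) [NormedAddCommGroup E]
    [InnerProductSpace ℝ E] [FiniteDimensional ℝ E], Module.finrank ℝ E = 2 * n →
    ∀ T : E →ₗ[ℝ] E, (∀ x y, ⟪T x, y⟫_ℝ = -⟪x, T y⟫_ℝ) →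
    ∃ (u v : Fin n → E) (a : Fin n → ℝ),
      (∀ i j, ⟪u i, u j⟫_ℝ = if i = j then 1 else 0) ∧
      (∀ i j, ⟪v i, v j⟫_ℝ = if i = j then 1 else 0) ∧
      (∀ i j, ⟪u i, v j⟫_ℝ = 0) ∧
      (∀ j, T (u j) = -a j • v j) ∧ (∀ j, T (v j) = a j • u j) := by
  induction n with
  | zero =>
    intro E _ _ _ _ T _
    exact ⟨Fin.elim0, Fin.elim0, Fin.elim0, fun i => i.elim0, fun i => i.elim0,
      fun i => i.elim0, fun i => i.elim0, fun i => i.elim0⟩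
  | succ n ih =>
    intro E _ _ _ hE T hT
    obtain ⟨u, v, a, huu, hvv, huv, hTu, hTv⟩ := exists_skew_plane (by omega) T hT
    have hvu : ⟪v, u⟫_ℝ = 0 := by rw [real_inner_comm, huv]
    set K : Submodule ℝ E := Submodule.span ℝ {u, v} with hK
    have huK : u ∈ K := Submodule.subset_span (by simp)
    have hvK : v ∈ K := Submodule.subset_span (by simp)
    have hmem : ∀ w, w ∈ Kᗮ ↔ ⟪u, w⟫_ℝ = 0 ∧ ⟪v, w⟫_ℝ = 0 := by
      intro w
      refine ⟨fun h => ⟨h u huK, h v hvK⟩, fun h x hx => ?_⟩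
      obtain ⟨α, β, rfl⟩ := Submodule.mem_span_pair.1 hx
      rw [inner_add_left, inner_smul_left, inner_smul_left, h.1, h.2]
      simp
    have hKdim : Module.finrank ℝ K = 2 := by
      have hli : LinearIndependent ℝ ![u, v] := by
        rw [LinearIndependent.pair_iff]
        intro s t hst
        have h1 := congrArg (fun x => ⟪u, x⟫_ℝ) hst
        have h2 := congrArg (fun x => ⟪v, x⟫_ℝ) hst
        simp only [inner_add_right, inner_smul_right, huu, huv, hvv, hvu, inner_zero_right] at h1 h2
        constructor <;> linarith
      have := finrank_span_eq_card hli
      rwa [show Set.range ![u, v] = {u, v} by simp [Set.pair_comm], Fintype.card_fin] at this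
    have hdim : Module.finrank ℝ Kᗮ = 2 * n := by
      have := K.finrank_add_finrank_orthogonal
      omega
    have hinv : ∀ w ∈ Kᗮ, T w ∈ Kᗮ := by
      intro w hw
      rw [hmem] at hw ⊢
      constructor
      · rw [← neg_inj, ← hT, hTu, inner_smul_left, hw.2]
        simp
      · rw [← neg_inj, ← hT, hTv, inner_smul_left, hw.1]
        simp
    obtain ⟨u', v', a', h1, h2, h3, h4, h5⟩ := ih Kᗮ hdim (T.restrict hinv) (by
      intro x y
      simpa using hT x y)
    have hu' : ∀ i, ⟪u, (u' i : E)⟫_ℝ = 0 := fun i => ((hmem _).1 (u' i).2).1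
    have hv' : ∀ i, ⟪u, (v' i : E)⟫_ℝ = 0 := fun i => ((hmem _).1 (v' i).2).1
    have hu'' : ∀ i, ⟪v, (u' i : E)⟫_ℝ = 0 := fun i => ((hmem _).1 (u' i).2).2
    have hv'' : ∀ i, ⟪v, (v' i : E)⟫_ℝ = 0 := fun i => ((hmem _).1 (v' i).2).2
    have h1' : ∀ i j, ⟪(u' i : E), u' j⟫_ℝ = if i = j then 1 else 0 := h1
    have h2' : ∀ i j, ⟪(v' i : E), v' j⟫_ℝ = if i = j then 1 else 0 := h2
    have h3' : ∀ i j, ⟪(u' i : E), v' j⟫_ℝ = 0 := h3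
    have h4' : ∀ j, T (u' j) = -a' j • (v' j : E) := fun j => congrArg Subtype.val (h4 j)
    have h5' : ∀ j, T (v' j) = a' j • (u' j : E) := fun j => congrArg Subtype.val (h5 j)
    refine ⟨Fin.cons u fun i => u' i, Fin.cons v fun i => v' i, Fin.cons a a', ?_, ?_, ?_, ?_, ?_⟩
    · simp only [Fin.forall_fin_succ, Fin.cons_zero, Fin.cons_succ, h1', hu', huu,
        real_inner_comm u, Fin.succ_inj]
      simp [Fin.succ_ne_zero, (Fin.succ_ne_zero _).symm]
    · simp only [Fin.forall_fin_succ, Fin.cons_zero, Fin.cons_succ, h2', hv'', hvv,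
        real_inner_comm v, Fin.succ_inj]
      simp [Fin.succ_ne_zero, (Fin.succ_ne_zero _).symm]
    · simp only [Fin.forall_fin_succ, Fin.cons_zero, Fin.cons_succ, h3', hv', huv]
      refine ⟨⟨trivial, fun _ => trivial⟩, fun i => ⟨?_, fun _ => trivial⟩⟩
      rw [real_inner_comm, hu'']
    · simpa only [Fin.forall_fin_succ, Fin.cons_zero, Fin.cons_succ] using ⟨hTu, h4'⟩
    · simpa only [Fin.forall_fin_succ, Fin.cons_zero, Fin.cons_succ] using ⟨hTv, h5'⟩

/-- The block diagonal skew-symmetric matrix with blocks `[[0, a_j], [-a_j, 0]]`. -/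
def skewBlocks {n : ℕ} (a : Fin n → ℝ) : Matrix (Fin 2 × Fin n) (Fin 2 × Fin n) ℝ :=
  Matrix.blockDiagonal fun j => !![0, a j; -a j, 0]

lemma exists_orthogonal_skewBlocks {n : ℕ} (γ : Matrix (Fin (2 * n)) (Fin (2 * n)) ℝ)
    (hγ : γᵀ = -γ) : ∃ (O : Matrix (Fin 2 × Fin n) (Fin (2 * n)) ℝ) (a : Fin n → ℝ),
      O * Oᵀ = 1 ∧ Oᵀ * O = 1 ∧ O * γ * Oᵀ = skewBlocks a := by
  have hT : ∀ x y : EuclideanSpace ℝ (Fin (2 * n)), ⟪Matrix.toEuclideanLin γ x, y⟫_ℝ =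
      -⟪x, Matrix.toEuclideanLin γ y⟫_ℝ := by
    intro x y
    simp only [PiLp.inner_apply, Matrix.toLpLin_apply, Matrix.mulVec, dotProduct,
      RCLike.inner_apply, conj_trivial, Finset.mul_sum, Finset.sum_mul, ← Finset.sum_neg_distrib]
    rw [Finset.sum_comm]
    refine Finset.sum_congr rfl fun i _ => Finset.sum_congr rfl fun j _ => ?_
    have : γ j i = -γ i j := congrFun (congrFun hγ i) j
    rw [this]
    ring
  obtain ⟨u, v, a, h1, h2, h3, h4, h5⟩ :=
    exists_skew_normalForm n (EuclideanSpace ℝ (Fin (2 * n))) (by simp) _ hT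
  let w : Fin 2 × Fin n → EuclideanSpace ℝ (Fin (2 * n)) := fun p => if p.1 = 0 then u p.2 else v p.2
  let O : Matrix (Fin 2 × Fin n) (Fin (2 * n)) ℝ := Matrix.of fun p l => w p l
  have hOa : ∀ p l, O p l = w p l := fun _ _ => rfl
  have hOO : ∀ p q, (O * Oᵀ) p q = ⟪w p, w q⟫_ℝ := by
    intro p q
    simp [Matrix.mul_apply, PiLp.inner_apply, hOa, mul_comm]
  have hOγ : ∀ p q, (O * γ * Oᵀ) p q = ⟪w p, Matrix.toEuclideanLin γ (w q)⟫_ℝ := by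
    intro p q
    rw [Matrix.mul_assoc]
    simp [Matrix.mul_apply, PiLp.inner_apply, hOa, mul_comm, Matrix.toLpLin_apply,
      Matrix.mulVec, dotProduct]
  have hO : O * Oᵀ = 1 := by
    ext ⟨s, i⟩ ⟨t, j⟩
    rw [hOO]
    have h3' : ∀ i j, ⟪v i, u j⟫_ℝ = 0 := fun i j => by rw [real_inner_comm, h3]
    fin_cases s <;> fin_cases t <;> simp [w, h1, h2, h3, h3', Matrix.one_apply]
  refine ⟨O, a, hO, (Matrix.mul_eq_one_comm_of_card_eq _ _ _ (by simp)).1 hO, ?_⟩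
  ext ⟨s, i⟩ ⟨t, j⟩
  rw [hOγ, skewBlocks, Matrix.blockDiagonal_apply]
  have h3' : ∀ i j, ⟪v i, u j⟫_ℝ = 0 := fun i j => by rw [real_inner_comm, h3]
  fin_cases s <;> fin_cases t <;>
    simp [w, h1, h2, h3, h3', h4, h5, inner_smul_right] <;> split_ifs with h <;> simp [h]

/-- The roots of the characteristic polynomial of a skew-symmetric matrix in normal form. -/
lemma hasSpectrum_of_skewBlocks {n : ℕ} {γ : Matrix (Fin (2 * n)) (Fin (2 * n)) ℝ}
    {O : Matrix (Fin 2 × Fin n) (Fin (2 * n)) ℝ} {a : Fin n → ℝ}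
    (h2 : Oᵀ * O = 1) (h : O * γ * Oᵀ = skewBlocks a) : HasSpectrum γ a := by
  have hreal : γ.charpoly = (skewBlocks a).charpoly := by
    rw [← h, Matrix.mul_assoc]
    -- `O` has different row and column index types, so the rectangular version is needed; the extra
    -- power of `X` has exponent zero.
    have := Matrix.charpoly_mul_comm_of_le O (γ * Oᵀ) (by simp)
    rw [this, Matrix.mul_assoc, h2, Matrix.mul_one]
    simp
  have hblock : (skewBlocks a).charpoly =
      ∏ j, (Polynomial.X * Polynomial.X + Polynomial.C (a j) * Polynomial.C (a j)) := by
    have : (skewBlocks a).charmatrix = Matrix.blockDiagonal fun j =>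
        Matrix.charmatrix !![0, a j; -a j, 0] := by
      ext ⟨s, i⟩ ⟨t, j⟩
      simp only [skewBlocks, Matrix.charmatrix_apply, Matrix.blockDiagonal_apply,
        Matrix.diagonal_apply, Prod.mk.injEq]
      by_cases hij : i = j <;> simp [hij]
    rw [Matrix.charpoly, this, Matrix.det_blockDiagonal]
    refine Finset.prod_congr rfl fun j _ => ?_
    simp [Matrix.det_fin_two]
  unfold HasSpectrum
  have hmap : (γ.map fun x : ℝ => (x : ℂ)).charpoly = γ.charpoly.map Complex.ofRealHom :=
    Matrix.charpoly_map γ Complex.ofRealHom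
  have hfac : ∀ j, ((Polynomial.X * Polynomial.X +
      Polynomial.C (a j) * Polynomial.C (a j)).map Complex.ofRealHom : Polynomial ℂ) =
      (Multiset.map (fun z => Polynomial.X - Polynomial.C z)
        {Complex.I * (a j : ℂ), -(Complex.I * (a j : ℂ))}).prod := by
    intro j
    have hI : (Polynomial.C Complex.I * Polynomial.C Complex.I : Polynomial ℂ) = -1 := by
      rw [← Polynomial.C_mul, Complex.I_mul_I]
      simp
    simp only [Polynomial.map_add, Polynomial.map_mul, Polynomial.map_X, Polynomial.map_C,
      Complex.ofRealHom_eq_coe, Multiset.insert_eq_cons, Multiset.map_cons, Multiset.prod_cons,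
      Multiset.map_singleton, Multiset.prod_singleton, Polynomial.C_mul, Polynomial.C_neg]
    linear_combination ((Polynomial.C (a j : ℂ)) ^ 2) * hI
  rw [hmap, hreal, hblock, Polynomial.map_prod, Finset.prod_congr rfl fun j _ => hfac j,
    Polynomial.roots_prod _ _ (Finset.prod_ne_zero_iff.2 fun j _ =>
      (Polynomial.monic_multiset_prod_of_monic _ _ fun z _ => Polynomial.monic_X_sub_C z).ne_zero)]
  simp only [Polynomial.roots_multiset_prod_X_sub_C]
  rfl

open scoped Kronecker

/-! ### Jordan-Wigner factorization of the Fock space of two subsystems -/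

/-- The occupation number basis of a bipartite system. -/
def fockEquiv (nA nB : ℕ) : Finset (Fin nA) × Finset (Fin nB) ≃ Finset (Fin (nA + nB)) :=
  Finset.sumEquiv.symm.toEquiv.trans finSumFinEquiv.finsetCongr

lemma castAdd_mem_fockEquiv {nA nB : ℕ} (i : Fin nA) (p : Finset (Fin nA) × Finset (Fin nB)) :
    Fin.castAdd nB i ∈ fockEquiv nA nB p ↔ i ∈ p.1 := by
  rw [fockEquiv, Equiv.trans_apply, Equiv.finsetCongr_apply, ← finSumFinEquiv_apply_left,
    Finset.mem_map_equiv, Equiv.symm_apply_apply]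
  simp [Finset.sumEquiv]

lemma natAdd_mem_fockEquiv {nA nB : ℕ} (i : Fin nB) (p : Finset (Fin nA) × Finset (Fin nB)) :
    Fin.natAdd nA i ∈ fockEquiv nA nB p ↔ i ∈ p.2 := by
  rw [fockEquiv, Equiv.trans_apply, Equiv.finsetCongr_apply, ← finSumFinEquiv_apply_right,
    Finset.mem_map_equiv, Equiv.symm_apply_apply]
  simp [Finset.sumEquiv]

lemma card_fockEquiv {nA nB : ℕ} (p : Finset (Fin nA) × Finset (Fin nB)) :
    (fockEquiv nA nB p).card = p.1.card + p.2.card := by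
  simp [fockEquiv, Finset.sumEquiv]

lemma fockEquiv_ext {nA nB : ℕ} {U U' : Finset (Fin (nA + nB))}
    (hA : ∀ i, Fin.castAdd nB i ∈ U ↔ Fin.castAdd nB i ∈ U')
    (hB : ∀ i, Fin.natAdd nA i ∈ U ↔ Fin.natAdd nA i ∈ U') : U = U' := by
  ext x
  induction x using Fin.addCases with
  | left i => exact hA i
  | right i => exact hB i

lemma castAdd_ne_natAdd {nA nB : ℕ} (i : Fin nA) (j : Fin nB) :
    Fin.castAdd nB i ≠ Fin.natAdd nA j := by
  intro h
  have := congrArg Fin.val h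
  simp at this
  omega

lemma symmDiff_castAdd {nA nB : ℕ} (p : Finset (Fin nA) × Finset (Fin nB)) (i : Fin nA) :
    symmDiff (fockEquiv nA nB p) {Fin.castAdd nB i} =
      fockEquiv nA nB (symmDiff p.1 {i}, p.2) := by
  refine fockEquiv_ext (fun x => ?_) (fun x => ?_)
  · simp [Finset.mem_symmDiff, castAdd_mem_fockEquiv]
  · simp [Finset.mem_symmDiff, natAdd_mem_fockEquiv, (castAdd_ne_natAdd i x).symm]

lemma symmDiff_natAdd {nA nB : ℕ} (p : Finset (Fin nA) × Finset (Fin nB)) (i : Fin nB) :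
    symmDiff (fockEquiv nA nB p) {Fin.natAdd nA i} =
      fockEquiv nA nB (p.1, symmDiff p.2 {i}) := by
  refine fockEquiv_ext (fun x => ?_) (fun x => ?_)
  · simp [Finset.mem_symmDiff, castAdd_mem_fockEquiv, castAdd_ne_natAdd]
  · simp [Finset.mem_symmDiff, natAdd_mem_fockEquiv]

lemma jwSign_castAdd {nA nB : ℕ} (p : Finset (Fin nA) × Finset (Fin nB)) (i : Fin nA) :
    jwSign (Fin.castAdd nB i) (fockEquiv nA nB p) = jwSign i p.1 := by
  unfold jwSign
  have : (fockEquiv nA nB p).filter (fun x => x < Fin.castAdd nB i) =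
      fockEquiv nA nB (p.1.filter (fun x => x < i), ∅) := by
    refine fockEquiv_ext (fun x => ?_) (fun x => ?_)
    · have h : Fin.castAdd nB x < Fin.castAdd nB i ↔ x < i := Iff.rfl
      simp [castAdd_mem_fockEquiv, h]
    · have h : ¬ Fin.natAdd nA x < Fin.castAdd nB i := by
        rw [Fin.lt_def, Fin.val_natAdd, Fin.val_castAdd]
        omega
      simp [natAdd_mem_fockEquiv, h]
  rw [this, card_fockEquiv]
  simp

lemma jwSign_natAdd {nA nB : ℕ} (p : Finset (Fin nA) × Finset (Fin nB)) (i : Fin nB) :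
    jwSign (Fin.natAdd nA i) (fockEquiv nA nB p) = (-1) ^ p.1.card * jwSign i p.2 := by
  unfold jwSign
  have : (fockEquiv nA nB p).filter (fun x => x < Fin.natAdd nA i) =
      fockEquiv nA nB (p.1, p.2.filter (fun x => x < i)) := by
    refine fockEquiv_ext (fun x => ?_) (fun x => ?_)
    · have h : Fin.castAdd nB x < Fin.natAdd nA i := by
        rw [Fin.lt_def, Fin.val_natAdd, Fin.val_castAdd]
        omega
      simp [castAdd_mem_fockEquiv, h]
    · simp [natAdd_mem_fockEquiv]
  rw [this, card_fockEquiv, pow_add]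

/-- The identification of the operators on a bipartite Fock space with those on the tensor
product of the Fock spaces of the subsystems. -/
def tensorIso (nA nB : ℕ) : FockOp (nA + nB) ≃ₐ[ℂ]
    Matrix (Finset (Fin nA) × Finset (Fin nB)) (Finset (Fin nA) × Finset (Fin nB)) ℂ :=
  Matrix.reindexAlgEquiv ℂ ℂ (fockEquiv nA nB).symm

lemma tensorIso_apply {nA nB : ℕ} (X : FockOp (nA + nB))
    (p q : Finset (Fin nA) × Finset (Fin nB)) :
    tensorIso nA nB X p q = X (fockEquiv nA nB p) (fockEquiv nA nB q) := rfl

lemma trace_tensorIso {nA nB : ℕ} (X : FockOp (nA + nB)) :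
    (tensorIso nA nB X).trace = X.trace := by
  simp only [Matrix.trace, Matrix.diag, tensorIso_apply]
  exact Equiv.sum_comp (fockEquiv nA nB) fun S => X S S

/-- The Majorana indices of the first subsystem. -/
def indexA {nA nB : ℕ} (i : Fin (2 * nA)) : Fin (2 * (nA + nB)) := Fin.castLE (by omega) i

/-- The Majorana indices of the second subsystem. -/
def indexB {nA nB : ℕ} (i : Fin (2 * nB)) : Fin (2 * (nA + nB)) := ⟨2 * nA + i, by omega⟩

lemma modeOf_indexA {nA nB : ℕ} (i : Fin (2 * nA)) :
    modeOf (indexA i : Fin (2 * (nA + nB))) = Fin.castAdd nB (modeOf i) := rfl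

lemma modeOf_indexB {nA nB : ℕ} (i : Fin (2 * nB)) :
    modeOf (indexB i : Fin (2 * (nA + nB))) = Fin.natAdd nA (modeOf i) := by
  ext
  simp only [modeOf, indexB, Fin.val_natAdd]
  omega

/-- The parity `(-1)^N` of the occupation number. -/
def numberParity (n : ℕ) : FockOp n := Matrix.diagonal fun S => (-1) ^ S.card

lemma tensorIso_majorana_indexA {nA nB : ℕ} (i : Fin (2 * nA)) :
    tensorIso nA nB (majorana (indexA i)) = majorana i ⊗ₖ (1 : FockOp nB) := by
  ext ⟨S, T⟩ ⟨S', T'⟩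
  rw [tensorIso_apply, majorana_apply, modeOf_indexA, symmDiff_castAdd, jwSign_castAdd,
    Matrix.kroneckerMap_apply, majorana_apply, Matrix.one_apply]
  simp only [EmbeddingLike.apply_eq_iff_eq, Prod.mk.injEq, localPhase, modeOf_indexA,
    castAdd_mem_fockEquiv]
  have : ((indexA i : Fin (2 * (nA + nB))) : ℕ) = i := rfl
  rw [this]
  by_cases h1 : S = symmDiff S' {modeOf i} <;> by_cases h2 : T = T' <;> simp [h1, h2]

/-- All modes of `A` precede those of `B`, so the Jordan-Wigner sign of a mode of `B` picks up the
parity of the whole occupation of `A`. -/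
lemma tensorIso_majorana_indexB {nA nB : ℕ} (i : Fin (2 * nB)) :
    tensorIso nA nB (majorana (indexB i)) = numberParity nA ⊗ₖ majorana i := by
  ext ⟨S, T⟩ ⟨S', T'⟩
  rw [tensorIso_apply, majorana_apply, modeOf_indexB, symmDiff_natAdd, jwSign_natAdd,
    Matrix.kroneckerMap_apply, majorana_apply, numberParity, Matrix.diagonal_apply]
  simp only [EmbeddingLike.apply_eq_iff_eq, Prod.mk.injEq, localPhase, modeOf_indexB,
    natAdd_mem_fockEquiv]
  have : ((indexB i : Fin (2 * (nA + nB))) : ℕ) % 2 = i % 2 := by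
    simp only [indexB]
    omega
  rw [this]
  by_cases h1 : S = S'
  · by_cases h2 : T = symmDiff T' {modeOf i}
    · simp only [h1, h2, and_self, if_true]
      ring
    · simp [h2]
  · simp [h1]

lemma orderedMonomial_kronecker {ι κ : Type*} [Fintype ι] [DecidableEq ι] [Fintype κ]
    [DecidableEq κ] {N : ℕ} (Z : Matrix ι ι ℂ) (c : Fin N → Matrix κ κ ℂ) (τ : Fin N → Fin 2) :
    orderedMonomial (fun i => Z ⊗ₖ c i) τ = (Z ^ ∑ i, (τ i : ℕ)) ⊗ₖ orderedMonomial c τ := by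
  induction N with
  | zero => simp [orderedMonomial]
  | succ N ih =>
    rw [orderedMonomial_succ, orderedMonomial_succ, ih, Fin.sum_univ_succ, pow_add,
      Matrix.mul_kronecker_mul]
    congr 1
    rcases fin_two_cases (τ 0) with ht | ht <;> simp [ht]

lemma list_prod_kronecker_one {ι κ : Type*} [Fintype ι] [DecidableEq ι] [Fintype κ]
    [DecidableEq κ] (L : List (Matrix ι ι ℂ)) :
    (L.map fun x => x ⊗ₖ (1 : Matrix κ κ ℂ)).prod = L.prod ⊗ₖ (1 : Matrix κ κ ℂ) := by
  induction L with
  | nil => simp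
  | cons a L ih =>
    rw [List.map_cons, List.prod_cons, List.prod_cons, ih, ← Matrix.mul_kronecker_mul, one_mul]

lemma kronecker_one_pow {ι κ : Type*} [Fintype ι] [DecidableEq ι] [Fintype κ]
    [DecidableEq κ] (x : Matrix ι ι ℂ) (q : ℕ) :
    (x ⊗ₖ (1 : Matrix κ κ ℂ)) ^ q = (x ^ q) ⊗ₖ (1 : Matrix κ κ ℂ) := by
  simpa using list_prod_kronecker_one (κ := κ) (List.replicate q x)

lemma tensorIso_majoranaProd {nA nB q : ℕ} (j : Fin q → Fin (2 * nA)) :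
    tensorIso nA nB (majoranaProd fun i => indexA (j i)) = majoranaProd j ⊗ₖ (1 : FockOp nB) := by
  rw [majoranaProd, majoranaProd, map_list_prod, List.map_ofFn, ← list_prod_kronecker_one,
    List.map_ofFn]
  congr 2
  ext1 i
  exact tensorIso_majorana_indexA (j i)

lemma list_ofFn_index {α : Type*} {nA nB : ℕ} (f : Fin (2 * (nA + nB)) → α) :
    List.ofFn f = (List.ofFn fun i => f (indexA i)) ++ List.ofFn fun i => f (indexB i) := by
  rw [List.ofFn_congr (mul_add 2 nA nB), List.ofFn_add]
  rfl

lemma tensorIso_monomial {nA nB : ℕ} (τ : Fin (2 * (nA + nB)) → Fin 2) :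
    tensorIso nA nB (monomial τ) =
      (monomial (fun i => τ (indexA i)) * numberParity nA ^ ∑ i, (τ (indexB i) : ℕ)) ⊗ₖ
        monomial (fun i => τ (indexB i)) := by
  rw [monomial, map_list_prod, list_ofFn_index, List.map_append, List.prod_append,
    List.map_ofFn, List.map_ofFn]
  have hA : (List.ofFn ((tensorIso nA nB) ∘ fun i => majorana (indexA i) ^
      (τ (indexA i) : ℕ))).prod = monomial (fun i => τ (indexA i)) ⊗ₖ (1 : FockOp nB) := by
    rw [monomial, ← list_prod_kronecker_one, List.map_ofFn]
    congr 2
    ext1 i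
    simp [tensorIso_majorana_indexA, kronecker_one_pow]
  have hB : (List.ofFn ((tensorIso nA nB) ∘ fun i => majorana (indexB i) ^
      (τ (indexB i) : ℕ))).prod =
      (numberParity nA ^ ∑ i, (τ (indexB i) : ℕ)) ⊗ₖ monomial (fun i => τ (indexB i)) := by
    rw [monomial_eq_orderedMonomial, ← orderedMonomial_kronecker, orderedMonomial]
    congr 2
    ext1 i
    simp [tensorIso_majorana_indexB]
  rw [hA, hB, ← Matrix.mul_kronecker_mul, one_mul]

/-! ### The partial transpose -/

lemma sum_add_mod_two (n c : ℕ) : ∑ i ∈ Finset.range (2 * n), (i + c) % 2 = n := by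
  induction n with
  | zero => simp
  | succ n ih =>
    rw [mul_add, mul_one, Finset.sum_range_succ, Finset.sum_range_succ, ih]
    omega

/-- The exponents of the monomial that intertwines the Majorana operators with their
transposes. -/
def transposeBits (n : ℕ) (i : Fin (2 * n)) : Fin 2 := ⟨((i : ℕ) + n) % 2, Nat.mod_lt _ two_pos⟩

/-- Moving `majorana i` past a monomial of degree `n` with bits `τ` gives `(-1) ^ (n + τ i)`, and
this must equal the transposition sign `(-1) ^ i`. That dictates `τ i ≡ i + n`, and this choice
indeed has degree `n`. -/
lemma monomial_transposeBits_mul_transpose {n : ℕ} (i : Fin (2 * n)) :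
    monomial (transposeBits n) * (majorana i)ᵀ = majorana i * monomial (transposeBits n) := by
  have hsum : ∑ i, (transposeBits n i : ℕ) = n := by
    simp only [transposeBits]
    rw [Fin.sum_univ_eq_sum_range (fun i => (i + n) % 2), sum_add_mod_two]
  rw [majorana_mul_monomial, majorana_transpose, mul_smul_comm, hsum]
  congr 1
  simp only [transposeBits]
  rw [neg_one_pow_eq_pow_mod_two, neg_one_pow_eq_pow_mod_two (n := n + _)]
  congr 1
  omega

lemma mul_reverse_map_prod {M : Type*} [Monoid M] (V : M) (f : M → M) (L : List M)
    (h : ∀ x ∈ L, V * f x = x * V) : V * (L.map f).reverse.prod = L.reverse.prod * V := by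
  induction L with
  | nil => simp
  | cons a L ih =>
    simp only [List.map_cons, List.reverse_cons, List.prod_append, List.prod_cons, List.prod_nil,
      mul_one]
    rw [← mul_assoc, ih fun x hx => h x (by simp [hx]), mul_assoc, h a (by simp), mul_assoc]

/-- Conjugation restores each transposed factor, leaving only the reversed order, which costs
`d.choose 2` signs. -/
lemma transposeBits_conj_monomial {n : ℕ} (τ : Fin (2 * n) → Fin 2) :
    monomial (transposeBits n) * (monomial τ)ᵀ * (monomial (transposeBits n))ᴴ =
      ((-1 : ℂ) ^ ((∑ i, (τ i : ℕ)).choose 2)) • monomial τ := by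
  have h : monomial (transposeBits n) * (monomial τ)ᵀ =
      (List.ofFn fun i => majorana i ^ (τ i : ℕ)).reverse.prod * monomial (transposeBits n) := by
    rw [monomial.eq_def τ, Matrix.transpose_list_prod, mul_reverse_map_prod]
    intro x hx
    obtain ⟨i, rfl⟩ := (List.mem_ofFn' _ _).1 hx
    rcases fin_two_cases (τ i) with ht | ht
    · simp [ht]
    · simp [ht, monomial_transposeBits_mul_transpose]
  rw [h, reverse_orderedMonomial majorana τ fun _ _ => majorana_anticomm, mul_assoc,
    monomial_mul_conjTranspose_self, mul_one]
  rfl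

lemma choose_two_mod_two (d : ℕ) :
    d.choose 2 % 2 = if d % 4 = 0 ∨ d % 4 = 1 then 0 else 1 := by
  induction d with
  | zero => simp
  | succ d ih =>
    rw [Nat.choose_succ_succ' d 1, Nat.choose_one_right, Nat.add_mod, ih]
    split_ifs <;> omega

lemma degreeB_eq {nA nB : ℕ} (τ : Fin (2 * (nA + nB)) → Fin 2) :
    degreeB nA nB τ = ∑ i, (τ (indexB i) : ℕ) := by
  unfold degreeB
  rw [← List.sum_ofFn, list_ofFn_index, List.sum_append, List.sum_ofFn, List.sum_ofFn]
  rw [Finset.sum_eq_zero, zero_add]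
  · refine Finset.sum_congr rfl fun i _ => ?_
    simp [indexB]
  · intro i _
    have : ((indexA i : Fin (2 * (nA + nB))) : ℕ) = i := rfl
    rw [this, if_neg (by omega)]

lemma neg_one_pow_transposeExponent {nA nB : ℕ} (τ : Fin (2 * (nA + nB)) → Fin 2) :
    (-1 : ℂ) ^ transposeExponent nA nB τ =
      (-1) ^ ((∑ i, (τ (indexB i) : ℕ)).choose 2) := by
  rw [neg_one_pow_eq_pow_mod_two (n := Nat.choose _ _), choose_two_mod_two, transposeExponent,
    degreeB_eq]

/-- The transposition of the second tensor factor. -/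
def transposeSnd {ι κ : Type*} : Matrix (ι × κ) (ι × κ) ℂ →ₗ[ℂ] Matrix (ι × κ) (ι × κ) ℂ where
  toFun X := Matrix.of fun p q => X (p.1, q.2) (q.1, p.2)
  map_add' _ _ := rfl
  map_smul' _ _ := rfl

lemma transposeSnd_apply {ι κ : Type*} (X : Matrix (ι × κ) (ι × κ) ℂ) (p q : ι × κ) :
    transposeSnd X p q = X (p.1, q.2) (q.1, p.2) := rfl

lemma transposeSnd_kronecker {ι κ : Type*} (x : Matrix ι ι ℂ) (y : Matrix κ κ ℂ) :
    transposeSnd (x ⊗ₖ y) = x ⊗ₖ yᵀ := rfl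

/-- The fermionic partial transpose is unitarily equivalent to the transposition of the second
tensor factor. -/
lemma tensorIso_partialTranspose {nA nB : ℕ} (ρ : FockOp (nA + nB)) :
    tensorIso nA nB (partialTranspose nA nB ρ) =
      ((1 : FockOp nA) ⊗ₖ monomial (transposeBits nB)) * transposeSnd (tensorIso nA nB ρ) *
        ((1 : FockOp nA) ⊗ₖ (monomial (transposeBits nB))ᴴ) := by
  conv_rhs => rw [← sum_coeff_smul_monomial ρ]
  simp only [partialTranspose, map_sum, map_smul, Finset.mul_sum, Finset.sum_mul,
    mul_smul_comm, smul_mul_assoc, tensorIso_monomial, transposeSnd_kronecker,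
    ← Matrix.mul_kronecker_mul, one_mul, mul_one, transposeBits_conj_monomial]
  refine Finset.sum_congr rfl fun τ _ => ?_
  rw [neg_one_pow_transposeExponent, mul_smul, Matrix.kronecker_smul]

open scoped Kronecker MatrixOrder

/-! ### The trace of the square root -/

/-- The sum of the square roots of the eigenvalues. -/
def sqrtTrace {ι : Type*} [Fintype ι] [DecidableEq ι] (M : Matrix ι ι ℂ) : ℝ :=
  (M.charpoly.roots.map fun z => √z.re).sum

lemma traceNorm_eq_sqrtTrace {k : ℕ} (X : FockOp k) : traceNorm X = sqrtTrace (Xᴴ * X) := by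
  rw [traceNorm, sqrtTrace,
    (Matrix.isHermitian_conjTranspose_mul_self X).roots_charpoly_eq_eigenvalues, Multiset.map_map]
  rfl

section

variable {ι κ : Type*} [Fintype ι] [DecidableEq ι] [Fintype κ] [DecidableEq κ]

/-- Only the characteristic polynomial enters `sqrtTrace`, so neither positivity nor Hermiticity is
needed here. -/
lemma sqrtTrace_mul_comm (X Y : Matrix ι ι ℂ) : sqrtTrace (X * Y) = sqrtTrace (Y * X) := by
  rw [sqrtTrace, sqrtTrace, Matrix.charpoly_mul_comm]

lemma sqrtTrace_conj {U V : Matrix ι ι ℂ} (h : V * U = 1) (X : Matrix ι ι ℂ) :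
    sqrtTrace (U * X * V) = sqrtTrace X := by
  rw [sqrtTrace_mul_comm, ← mul_assoc, h, one_mul]

/-- Diagonalizing `R` shows that the roots for `R * R` are the squares of its nonnegative
eigenvalues. Any explicit positive square root thus computes `sqrtTrace`. -/
lemma sqrtTrace_mul_self {R : Matrix ι ι ℂ} (hR : R.PosSemidef) :
    sqrtTrace (R * R) = R.trace.re := by
  have hH := hR.isHermitian
  set U : Matrix ι ι ℂ := (hH.eigenvectorUnitary : Matrix ι ι ℂ) with hU
  set D : Matrix ι ι ℂ := Matrix.diagonal (RCLike.ofReal ∘ hH.eigenvalues) with hD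
  have hs : R = U * D * Uᴴ := by
    conv_lhs => rw [hH.spectral_theorem]
    rfl
  have hUU : Uᴴ * U = 1 := Unitary.coe_star_mul_self hH.eigenvectorUnitary
  have h2 : R * R = U * (D * D) * Uᴴ := by
    calc R * R = U * D * (Uᴴ * U) * D * Uᴴ := by rw [hs]; simp only [mul_assoc]
      _ = U * (D * D) * Uᴴ := by rw [hUU]; simp only [mul_assoc, one_mul]
  have hroots : ∀ d : ι → ℂ, (∏ i, (Polynomial.X - Polynomial.C (d i))).roots =
      Finset.univ.val.map d := by
    intro d
    rw [← Polynomial.roots_multiset_prod_X_sub_C (Finset.univ.val.map d), Multiset.map_map]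
    rfl
  rw [h2, sqrtTrace_conj hUU, sqrtTrace, hD, Matrix.diagonal_mul_diagonal,
    Matrix.charpoly_diagonal, hroots, Multiset.map_map, hH.trace_eq_sum_eigenvalues]
  rw [Complex.re_sum]
  refine congrArg Multiset.sum (Multiset.map_congr rfl fun i _ => ?_)
  simp [Real.sqrt_mul_self (hR.eigenvalues_nonneg i)]

lemma exists_posSemidef_sqrt {P : Matrix ι ι ℂ} (hP : P.PosSemidef) :
    ∃ R : Matrix ι ι ℂ, R.PosSemidef ∧ R * R = P :=
  ⟨CFC.sqrt P, Matrix.nonneg_iff_posSemidef.1 (CFC.sqrt_nonneg P),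
    CFC.sqrt_mul_sqrt_self P (Matrix.nonneg_iff_posSemidef.2 hP)⟩

lemma posSemidef_trace_im {P : Matrix ι ι ℂ} (hP : P.PosSemidef) : P.trace.im = 0 := by
  rw [hP.isHermitian.trace_eq_sum_eigenvalues, Complex.im_sum]
  simp

lemma sqrtTrace_kronecker {P : Matrix ι ι ℂ} {Q : Matrix κ κ ℂ} (hP : P.PosSemidef)
    (hQ : Q.PosSemidef) : sqrtTrace (P ⊗ₖ Q) = sqrtTrace P * sqrtTrace Q := by
  obtain ⟨R, hR, rfl⟩ := exists_posSemidef_sqrt hP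
  obtain ⟨S, hS, rfl⟩ := exists_posSemidef_sqrt hQ
  rw [Matrix.mul_kronecker_mul, sqrtTrace_mul_self (hR.kronecker hS), sqrtTrace_mul_self hR,
    sqrtTrace_mul_self hS, Matrix.trace_kronecker, Complex.mul_re, posSemidef_trace_im hR]
  simp

end

/-! ### Negativity of a pure state -/

lemma sqrtTrace_tensorIso {nA nB : ℕ} (X : FockOp (nA + nB)) :
    sqrtTrace (tensorIso nA nB X) = sqrtTrace X := by
  rw [sqrtTrace, sqrtTrace]
  congr 3
  exact Matrix.charpoly_reindex (fockEquiv nA nB).symm X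

lemma tensorIso_conjTranspose {nA nB : ℕ} (X : FockOp (nA + nB)) :
    tensorIso nA nB Xᴴ = (tensorIso nA nB X)ᴴ := rfl

/-- The coefficient matrix of a vector of a bipartite Fock space. -/
def coeffMatrix {n : ℕ} (ψ : Finset (Fin (n + n)) → ℂ) : FockOp n :=
  Matrix.of fun S T => ψ (fockEquiv n n (S, T))

/-- The partially transposed projector has entries `ψ(s, t') * star ψ(s', t)`: in the product with
its adjoint the two summation variables decouple. -/
lemma transposeSnd_pure {n : ℕ} (ψ : Finset (Fin (n + n)) → ℂ) :
    (transposeSnd (tensorIso n n (Matrix.vecMulVec ψ (star ψ))))ᴴ *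
      transposeSnd (tensorIso n n (Matrix.vecMulVec ψ (star ψ))) =
    (coeffMatrix ψ * (coeffMatrix ψ)ᴴ) ⊗ₖ ((coeffMatrix ψ)ᴴ * coeffMatrix ψ) := by
  ext ⟨s, t⟩ ⟨s', t'⟩
  simp only [Matrix.mul_apply, Matrix.kroneckerMap_apply, Matrix.conjTranspose_apply,
    transposeSnd_apply, tensorIso_apply, Matrix.vecMulVec_apply, coeffMatrix, Matrix.of_apply,
    Pi.star_apply, Fintype.sum_prod_type, Finset.sum_mul_sum, star_mul, star_star]
  rw [Finset.sum_comm]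
  refine Finset.sum_congr rfl fun v _ => Finset.sum_congr rfl fun u _ => ?_
  ring

lemma traceNorm_partialTranspose_pure {n : ℕ} (ψ : Finset (Fin (n + n)) → ℂ) :
    traceNorm (partialTranspose n n (Matrix.vecMulVec ψ (star ψ))) =
      sqrtTrace (coeffMatrix ψ * (coeffMatrix ψ)ᴴ) ^ 2 := by
  set V := monomial (transposeBits n)
  set X := transposeSnd (tensorIso n n (Matrix.vecMulVec ψ (star ψ))) with hX
  have hV : Vᴴ * V = 1 := monomial_conjTranspose_mul_self _
  have hU : ((1 : FockOp n) ⊗ₖ Vᴴ) * ((1 : FockOp n) ⊗ₖ V) = 1 := by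
    rw [← Matrix.mul_kronecker_mul, hV, one_mul, Matrix.one_kronecker_one]
  have hW : ((1 : FockOp n) ⊗ₖ V)ᴴ = (1 : FockOp n) ⊗ₖ Vᴴ := by
    rw [Matrix.conjTranspose_kronecker, Matrix.conjTranspose_one]
  rw [traceNorm_eq_sqrtTrace, ← sqrtTrace_tensorIso, map_mul, tensorIso_conjTranspose,
    tensorIso_partialTranspose, ← hX, ← hW]
  rw [← hW] at hU
  set W := (1 : FockOp n) ⊗ₖ V
  have : (W * X * Wᴴ)ᴴ * (W * X * Wᴴ) = W * (Xᴴ * X) * Wᴴ := by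
    rw [Matrix.conjTranspose_mul, Matrix.conjTranspose_mul, Matrix.conjTranspose_conjTranspose]
    calc W * (Xᴴ * Wᴴ) * (W * X * Wᴴ) = W * Xᴴ * (Wᴴ * W) * X * Wᴴ := by simp only [mul_assoc]
      _ = W * (Xᴴ * X) * Wᴴ := by rw [hU]; simp only [mul_assoc, one_mul]
  -- `C Cᴴ` and `Cᴴ C` have the same `sqrtTrace`, whence the square.
  rw [this, sqrtTrace_conj hU, hX, transposeSnd_pure,
    sqrtTrace_kronecker (Matrix.posSemidef_self_mul_conjTranspose _)
      (Matrix.posSemidef_conjTranspose_mul_self _),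
    sqrtTrace_mul_comm (coeffMatrix ψ)ᴴ, sq]

/-- Expectation values of operators on the first subsystem. -/
lemma trace_pure_mul {n : ℕ} (ψ : Finset (Fin (n + n)) → ℂ) {X : FockOp (n + n)} {M : FockOp n}
    (hX : tensorIso n n X = M ⊗ₖ (1 : FockOp n)) :
    (Matrix.vecMulVec ψ (star ψ) * X).trace =
      (coeffMatrix ψ * (coeffMatrix ψ)ᴴ * M).trace := by
  rw [← trace_tensorIso, map_mul, hX]
  simp only [Matrix.trace, Matrix.diag, Matrix.mul_apply, Matrix.kroneckerMap_apply,
    Matrix.conjTranspose_apply, tensorIso_apply, Matrix.vecMulVec_apply, coeffMatrix,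
    Matrix.of_apply, Pi.star_apply, Fintype.sum_prod_type, Matrix.one_apply, mul_ite, mul_one,
    mul_zero, Finset.sum_ite_eq', Finset.mem_univ, if_true, Finset.sum_mul]
  refine Finset.sum_congr rfl fun s _ => ?_
  rw [Finset.sum_comm]

/-! ### Products of commuting factors -/

lemma ofFn_prod_mul_ofFn_prod {M : Type*} [Monoid M] {N : ℕ} (F G : Fin N → M)
    (h : ∀ i j, i ≠ j → Commute (F i) (G j)) :
    (List.ofFn F).prod * (List.ofFn G).prod = (List.ofFn fun i => F i * G i).prod := by
  induction N with
  | zero => simp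
  | succ N ih =>
    simp only [List.ofFn_succ, List.prod_cons]
    rw [← ih (fun i => F i.succ) (fun i => G i.succ) fun i j hij => h _ _ (by simpa using hij)]
    have hc : Commute (List.ofFn fun i => F i.succ).prod (G 0) := by
      refine Commute.list_prod_left _ _ fun x hx => ?_
      obtain ⟨i, rfl⟩ := (List.mem_ofFn' _ _).1 hx
      exact h _ _ (Fin.succ_ne_zero i)
    rw [mul_assoc, ← mul_assoc _ (G 0), hc.eq]
    simp only [mul_assoc]

section

variable {ι : Type*} [Fintype ι] [DecidableEq ι]

lemma posSemidef_ofFn_prod {N : ℕ} (F : Fin N → Matrix ι ι ℂ) (hF : ∀ i, (F i).PosSemidef)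
    (h : ∀ i j, i ≠ j → Commute (F i) (F j)) : (List.ofFn F).prod.PosSemidef := by
  induction N with
  | zero => simpa using Matrix.PosSemidef.one
  | succ N ih =>
    rw [List.ofFn_succ, List.prod_cons]
    have hr := ih (fun i => F i.succ) (fun i => hF _) fun i j hij => h _ _ (by simpa using hij)
    have hc : Commute (F 0) (List.ofFn fun i => F i.succ).prod := by
      refine Commute.list_prod_right _ _ fun x hx => ?_
      obtain ⟨i, rfl⟩ := (List.mem_ofFn' _ _).1 hx
      exact h _ _ (Fin.succ_ne_zero i).symm
    exact Matrix.nonneg_iff_posSemidef.1 (Commute.mul_nonneg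
      (Matrix.nonneg_iff_posSemidef.2 (hF 0)) (Matrix.nonneg_iff_posSemidef.2 hr) hc)

/-- A term containing `Q 0` anticommutes with the involution `m 0`, which commutes with all later
factors; its trace vanishes, so only the scalar parts survive. -/
lemma trace_ofFn_prod {N : ℕ} (x y : Fin N → ℂ) (Q m : Fin N → Matrix ι ι ℂ)
    (hm : ∀ i, m i * m i = 1) (hanti : ∀ i, m i * Q i = -(Q i * m i))
    (hcomm : ∀ i j, i ≠ j → Commute (m i) (Q j)) :
    (List.ofFn fun i => x i • (1 : Matrix ι ι ℂ) + y i • Q i).prod.trace =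
      (∏ i, x i) * Fintype.card ι := by
  induction N with
  | zero => simp
  | succ N ih =>
    rw [List.ofFn_succ, List.prod_cons, add_mul, smul_mul_assoc, one_mul, smul_mul_assoc,
      Matrix.trace_add, Matrix.trace_smul, Matrix.trace_smul, Fin.prod_univ_succ,
      ih (fun i => x i.succ) (fun i => y i.succ) (fun i => Q i.succ) (fun i => m i.succ)
        (fun i => hm _) (fun i => hanti _) fun i j hij => hcomm _ _ (by simpa using hij)]
    have hc : Commute (m 0) (List.ofFn fun i : Fin N =>
        x i.succ • (1 : Matrix ι ι ℂ) + y i.succ • Q i.succ).prod := by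
      refine Commute.list_prod_right _ _ fun z hz => ?_
      obtain ⟨i, rfl⟩ := (List.mem_ofFn' _ _).1 hz
      exact ((Commute.one_right _).smul_right _).add_right
        ((hcomm _ _ (Fin.succ_ne_zero i).symm).smul_right _)
    rw [trace_eq_zero_of_anticomm (hm 0)]
    · simp [mul_assoc]
    · rw [← mul_assoc, hanti, neg_mul, mul_assoc, hc.eq, mul_assoc]

end

lemma commutator_ofFn_prod {A : Type*} [Ring A] [Algebra ℂ A] {N : ℕ} (F : Fin N → A)
    (j : Fin N) (u v : A) (c : ℂ) (h : u * F j - F j * u = c • (v * F j + F j * v))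
    (hu : ∀ i, i ≠ j → Commute u (F i)) (hv : ∀ i, i ≠ j → Commute v (F i)) :
    u * (List.ofFn F).prod - (List.ofFn F).prod * u =
      c • (v * (List.ofFn F).prod + (List.ofFn F).prod * v) := by
  induction N with
  | zero => exact j.elim0
  | succ N ih =>
    rw [List.ofFn_succ, List.prod_cons]
    set R := (List.ofFn fun i => F i.succ).prod with hR
    induction j using Fin.cases with
    | zero =>
      have hcR : ∀ w, (∀ i, i ≠ 0 → Commute w (F i)) → Commute w R := by
        intro w hw
        refine Commute.list_prod_right _ _ fun x hx => ?_
        obtain ⟨i, rfl⟩ := (List.mem_ofFn' _ _).1 hx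
        exact hw _ (Fin.succ_ne_zero i)
      have h1 := (hcR u hu).eq
      have h2 := (hcR v hv).eq
      calc u * (F 0 * R) - F 0 * R * u = (u * F 0 - F 0 * u) * R := by
            rw [mul_assoc (F 0), ← h1]; noncomm_ring
        _ = c • (v * (F 0 * R) + F 0 * R * v) := by
            rw [h, smul_mul_assoc, mul_assoc (F 0) R, ← h2]; noncomm_ring
    | succ j =>
      have ih' := ih (fun i => F i.succ) j h (fun i hi => hu _ (by simpa using hi))
        (fun i hi => hv _ (by simpa using hi))
      rw [← hR] at ih'
      have h1 := (hu 0 (Fin.succ_ne_zero j).symm).eq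
      have h2 := (hv 0 (Fin.succ_ne_zero j).symm).eq
      calc u * (F 0 * R) - F 0 * R * u = F 0 * (u * R - R * u) := by
            rw [← mul_assoc u, h1]; noncomm_ring
        _ = c • (v * (F 0 * R) + F 0 * R * v) := by
            rw [ih', mul_smul_comm, ← mul_assoc v, h2]; noncomm_ring

/-! ### The Wick expansion from a commutation relation -/

lemma majorana_anticommutator {k : ℕ} (a b : Fin (2 * k)) :
    majorana a * majorana b + majorana b * majorana a =
      (if a = b then (2 : ℂ) else 0) • (1 : FockOp k) := by
  split_ifs with h
  · rw [h, majorana_mul_self, two_smul]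
  · rw [majorana_anticomm h, neg_add_cancel, zero_smul]

/-- Carry `majorana l` through the product: each passage gives a sign and, where indices coincide, a
contraction with coefficient `2`. -/
lemma majorana_mul_majoranaProd {k q : ℕ} (l : Fin (2 * k)) (s : Fin (q + 1) → Fin (2 * k)) :
    majorana l * majoranaProd s = (-1 : ℂ) ^ (q + 1) • (majoranaProd s * majorana l) +
      ∑ r : Fin (q + 1), ((-1 : ℂ) ^ (r : ℕ) * (if l = s r then 2 else 0)) •
        majoranaProd fun i => s (r.succAbove i) := by
  have hsucc : ∀ {q : ℕ} (s : Fin (q + 1) → Fin (2 * k)),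
      majoranaProd s = majorana (s 0) * majoranaProd fun i => s i.succ := by
    intro q s
    simp [majoranaProd, List.ofFn_succ]
  induction q with
  | zero =>
    have h := majorana_anticommutator l (s 0)
    have h1 : ∀ t : Fin 0 → Fin (2 * k), majoranaProd t = 1 := fun t => by simp [majoranaProd]
    have hsum : ∀ f : Fin (0 + 1) → FockOp k, ∑ r, f r = f 0 := fun f => Fin.sum_univ_one f
    rw [hsum, hsucc s, h1, h1, mul_one, Fin.val_zero, pow_zero, one_mul, ← h, pow_succ,
      pow_zero, one_mul, neg_one_smul]
    abel
  | succ q ih =>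
    have h := majorana_anticommutator l (s 0)
    rw [hsucc s, Fin.sum_univ_succ]
    simp only [Fin.val_zero, pow_zero, one_mul, Fin.succAbove_zero, Fin.val_succ]
    have hr : ∀ r : Fin (q + 1), (majoranaProd fun i => s (r.succ.succAbove i)) =
        majorana (s 0) * majoranaProd fun i => s (r.succAbove i).succ := by
      intro r
      rw [hsucc]
      simp
    simp only [hr]
    set M := majoranaProd fun i : Fin (q + 1) => s i.succ with hM
    have ih' := ih fun i => s i.succ
    rw [← hM] at ih'
    have h1 : majorana l * (majorana (s 0) * M) =
        (if l = s 0 then (2 : ℂ) else 0) • M - majorana (s 0) * (majorana l * M) := by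
      rw [← mul_assoc, eq_sub_of_add_eq h, sub_mul, smul_mul_assoc, one_mul, mul_assoc]
    rw [h1, ih', mul_add, mul_smul_comm, Finset.mul_sum, ← mul_assoc, pow_succ _ (q + 1)]
    simp only [mul_smul_comm, pow_succ _ (Fin.val _), mul_neg, neg_mul, mul_one, neg_smul,
      Finset.sum_neg_distrib]
    abel

/-- The commutation relation with the Majorana operators that characterizes the Gaussian operator
with covariance matrix `γ`. -/
def IsThermal {k : ℕ} (γ : Matrix (Fin (2 * k)) (Fin (2 * k)) ℝ) (σ : FockOp k) : Prop :=
  ∀ j, majorana j * σ - σ * majorana j =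
    ∑ l, (Complex.I * (γ j l : ℂ)) • (majorana l * σ + σ * majorana l)

/-- Multiply the thermal relation by `M = majoranaProd s` and take the trace. Since `M` is odd and
does not contain `j0`, cyclicity turns the left side into `-2 tr (σ m_{j0} M)`; on the right it
produces anticommutators of `M` with `m_l`, which remove one factor of `M` each. -/
lemma IsThermal.trace_succ {k p : ℕ} {γ : Matrix (Fin (2 * k)) (Fin (2 * k)) ℝ} {σ : FockOp k}
    (h : IsThermal γ σ) (j0 : Fin (2 * k)) (s : Fin (2 * p + 1) → Fin (2 * k))
    (hj : ∀ r, j0 ≠ s r) :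
    (σ * (majorana j0 * majoranaProd s)).trace =
      -Complex.I * ∑ r : Fin (2 * p + 1), (-1 : ℂ) ^ (r : ℕ) * (γ j0 (s r) : ℂ) *
        (σ * majoranaProd fun i => s (r.succAbove i)).trace := by
  have hodd : Odd (2 * p + 1) := odd_two_mul_add_one p
  set M := majoranaProd s with hM
  have hl : ∀ l, majorana l * M + M * majorana l =
      ∑ r : Fin (2 * p + 1), ((-1 : ℂ) ^ (r : ℕ) * (if l = s r then 2 else 0)) •
        majoranaProd fun i => s (r.succAbove i) := by
    intro l
    rw [hM, majorana_mul_majoranaProd, hodd.neg_one_pow, neg_one_smul]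
    abel
  have hanti : M * majorana j0 = -(majorana j0 * M) := by
    have := hl j0
    simp only [hj, if_false, mul_zero, zero_smul, Finset.sum_const_zero] at this
    exact eq_neg_of_add_eq_zero_right this
  have h1 := congrArg (fun X => (X * M).trace) (h j0)
  simp only [sub_mul, Finset.sum_mul, Matrix.trace_sub, Matrix.trace_sum, smul_mul_assoc,
    Matrix.trace_smul, add_mul, Matrix.trace_add] at h1
  have hcyc : ∀ l, (majorana l * σ * M).trace = (σ * (M * majorana l)).trace := by
    intro l
    rw [mul_assoc, Matrix.trace_mul_comm, mul_assoc]
  have hterm : ∀ l, (majorana l * σ * M).trace + (σ * majorana l * M).trace =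
      ∑ r : Fin (2 * p + 1), ((-1 : ℂ) ^ (r : ℕ) * (if l = s r then 2 else 0)) *
        (σ * majoranaProd fun i => s (r.succAbove i)).trace := by
    intro l
    rw [hcyc, mul_assoc σ, ← Matrix.trace_add, ← mul_add, add_comm, hl, Finset.mul_sum,
      Matrix.trace_sum]
    simp only [mul_smul_comm, Matrix.trace_smul, smul_eq_mul]
  simp only [hterm] at h1
  rw [hcyc, hanti, mul_neg, Matrix.trace_neg, mul_assoc σ] at h1
  have h2 : ∑ l, (Complex.I * (γ j0 l : ℂ)) • ∑ r : Fin (2 * p + 1),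
      ((-1 : ℂ) ^ (r : ℕ) * (if l = s r then 2 else 0)) *
        (σ * majoranaProd fun i => s (r.succAbove i)).trace =
      2 * Complex.I * ∑ r : Fin (2 * p + 1), (-1 : ℂ) ^ (r : ℕ) * (γ j0 (s r) : ℂ) *
        (σ * majoranaProd fun i => s (r.succAbove i)).trace := by
    simp only [smul_eq_mul, Finset.mul_sum]
    rw [Finset.sum_comm]
    refine Finset.sum_congr rfl fun r _ => ?_
    rw [Finset.sum_eq_single (s r)]
    · rw [if_pos rfl]
      ring
    · intro l _ hl
      rw [if_neg hl]
      ring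
    · simp
  rw [h2] at h1
  linear_combination (-1 / 2 : ℂ) * h1

lemma IsThermal.trace_eq_wickSum {k : ℕ} {γ : Matrix (Fin (2 * k)) (Fin (2 * k)) ℝ}
    {σ : FockOp k} (h : IsThermal γ σ) (htr : σ.trace = 1) (p : ℕ) :
    ∀ j : Fin (2 * p) → Fin (2 * k), Function.Injective j →
      (σ * majoranaProd j).trace = (-Complex.I) ^ p * ((wickSum γ j : ℝ) : ℂ) := by
  induction p with
  | zero =>
    intro j _
    rw [wickSum_zero]
    simpa [majoranaProd] using htr
  | succ p ih =>
    intro j hj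
    -- `2 * (p + 1)` unfolds to `2 * p + 1 + 1`, which exposes a first index to split off.
    let j' : Fin (2 * p + 1 + 1) → Fin (2 * k) := j
    have hj' : Function.Injective j' := hj
    have hcons : j = (Fin.cons (α := fun _ => Fin (2 * k)) (n := 2 * p + 1) (j' 0)
        fun i => j' i.succ : Fin (2 * p + 1 + 1) → Fin (2 * k)) := (Fin.cons_self_tail j').symm
    have hprod : majoranaProd j = majorana (j' 0) * majoranaProd fun i => j' i.succ := by
      change majoranaProd j' = _
      simp [majoranaProd, List.ofFn_succ]
    rw [hprod, h.trace_succ (j' 0) (fun i => j' i.succ)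
      (fun r hr => Fin.succ_ne_zero r (hj' hr).symm)]
    conv_rhs => rw [hcons, wickSum_succ]
    push_cast
    rw [pow_succ, mul_comm ((-Complex.I) ^ p), mul_assoc]
    congr 1
    rw [Finset.mul_sum]
    refine Finset.sum_congr rfl fun r _ => ?_
    rw [ih (fun i => j' (r.succAbove i).succ)
      (hj'.comp ((Fin.succ_injective _).comp Fin.succAbove_right_injective))]
    ring

/-! ### Rotated Majorana operators and the thermal operator -/

section Rotation

variable {n : ℕ}

/-- The rotated Majorana operators `∑_l O_{p l} m_l`. -/
def rotMajorana (O : Matrix (Fin 2 × Fin n) (Fin (2 * n)) ℝ) (p : Fin 2 × Fin n) : FockOp n :=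
  ∑ l, (O p l : ℂ) • majorana l

lemma rotMajorana_anticommutator {O : Matrix (Fin 2 × Fin n) (Fin (2 * n)) ℝ}
    (hO : O * Oᵀ = 1) (p q : Fin 2 × Fin n) :
    rotMajorana O p * rotMajorana O q + rotMajorana O q * rotMajorana O p =
      (if p = q then (2 : ℂ) else 0) • (1 : FockOp n) := by
  have h1 : rotMajorana O p * rotMajorana O q + rotMajorana O q * rotMajorana O p =
      ∑ l, ∑ l', ((O p l : ℂ) * (O q l' : ℂ)) •
        (majorana l * majorana l' + majorana l' * majorana l) := by
    simp only [rotMajorana, Finset.sum_mul_sum, smul_mul_smul_comm, smul_add,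
      Finset.sum_add_distrib]
    congr 1
    rw [Finset.sum_comm]
    simp only [mul_comm]
  have h2 : ∑ l, O p l * O q l = if p = q then 1 else 0 := by
    have := congrFun (congrFun hO p) q
    simpa [Matrix.mul_apply, Matrix.one_apply] using this
  have h3 := congrArg (fun x : ℝ => (x : ℂ)) h2
  push_cast at h3
  rw [h1]
  simp only [majorana_anticommutator, smul_smul]
  simp only [mul_ite, mul_zero, ← Finset.sum_smul, Finset.sum_ite_eq, Finset.mem_univ, if_true]
  rw [← Finset.sum_mul, h3]
  split_ifs <;> simp

lemma rotMajorana_mul_self {O : Matrix (Fin 2 × Fin n) (Fin (2 * n)) ℝ}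
    (hO : O * Oᵀ = 1) (p : Fin 2 × Fin n) : rotMajorana O p * rotMajorana O p = 1 := by
  have h := rotMajorana_anticommutator hO p p
  rw [if_pos rfl, ← two_smul ℂ] at h
  exact smul_right_injective _ two_ne_zero h

lemma rotMajorana_anticomm {O : Matrix (Fin 2 × Fin n) (Fin (2 * n)) ℝ}
    (hO : O * Oᵀ = 1) {p q : Fin 2 × Fin n} (hpq : p ≠ q) :
    rotMajorana O p * rotMajorana O q = -(rotMajorana O q * rotMajorana O p) := by
  have h := rotMajorana_anticommutator hO p q
  rw [if_neg hpq, zero_smul] at h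
  exact eq_neg_of_add_eq_zero_left h

lemma rotMajorana_conjTranspose (O : Matrix (Fin 2 × Fin n) (Fin (2 * n)) ℝ)
    (p : Fin 2 × Fin n) : (rotMajorana O p)ᴴ = rotMajorana O p := by
  simp [rotMajorana, Matrix.conjTranspose_sum, majorana_conjTranspose]

lemma parity_mul_rotMajorana (O : Matrix (Fin 2 × Fin n) (Fin (2 * n)) ℝ) (p : Fin 2 × Fin n) :
    parity n * rotMajorana O p = -(rotMajorana O p * parity n) := by
  simp only [rotMajorana, Finset.mul_sum, Finset.sum_mul, mul_smul_comm, smul_mul_assoc,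
    majorana_mul_parity, smul_neg, Finset.sum_neg_distrib, neg_neg]

lemma majorana_eq_sum_rotMajorana {O : Matrix (Fin 2 × Fin n) (Fin (2 * n)) ℝ}
    (hO : Oᵀ * O = 1) (j : Fin (2 * n)) :
    majorana j = ∑ p, (O p j : ℂ) • rotMajorana O p := by
  have h2 : ∀ l, ∑ p, O p j * O p l = if j = l then 1 else 0 := by
    intro l
    have := congrFun (congrFun hO j) l
    simpa [Matrix.mul_apply, Matrix.one_apply] using this
  simp only [rotMajorana, Finset.smul_sum, smul_smul]
  rw [Finset.sum_comm]
  simp only [← Finset.sum_smul]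
  rw [Finset.sum_eq_single j]
  · have h3 := congrArg (fun x : ℝ => (x : ℂ)) (h2 j)
    push_cast at h3
    rw [h3]
    simp
  · intro l _ hl
    have h3 := congrArg (fun x : ℝ => (x : ℂ)) (h2 l)
    push_cast at h3
    rw [h3, if_neg (Ne.symm hl)]
    simp
  · simp

/-- The Hermitian involution `i m'_{0j} m'_{1j}` of a pair of rotated Majorana operators. -/
def modeParity (O : Matrix (Fin 2 × Fin n) (Fin (2 * n)) ℝ) (j : Fin n) : FockOp n :=
  Complex.I • (rotMajorana O (0, j) * rotMajorana O (1, j))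

variable {O : Matrix (Fin 2 × Fin n) (Fin (2 * n)) ℝ}

lemma rotMajorana_anticomm_pair (hO : O * Oᵀ = 1) (j : Fin n) :
    rotMajorana O (1, j) * rotMajorana O (0, j) =
      -(rotMajorana O (0, j) * rotMajorana O (1, j)) :=
  rotMajorana_anticomm hO (by simp)

lemma modeParity_mul_self (hO : O * Oᵀ = 1) (j : Fin n) :
    modeParity O j * modeParity O j = 1 := by
  set u := rotMajorana O (0, j) with hu
  set v := rotMajorana O (1, j) with hv
  have h : u * v * (u * v) = -1 := by
    calc u * v * (u * v) = u * (v * u) * v := by simp only [mul_assoc]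
      _ = -((u * u) * (v * v)) := by
        rw [hu, hv, rotMajorana_anticomm_pair hO]; simp only [mul_neg, neg_mul, mul_assoc]
      _ = -1 := by rw [rotMajorana_mul_self hO, rotMajorana_mul_self hO, one_mul]
  rw [modeParity, smul_mul_smul_comm, ← hu, ← hv, h, Complex.I_mul_I, neg_one_smul, neg_neg]

lemma modeParity_conjTranspose (hO : O * Oᵀ = 1) (j : Fin n) :
    (modeParity O j)ᴴ = modeParity O j := by
  rw [modeParity, Matrix.conjTranspose_smul, Matrix.conjTranspose_mul, rotMajorana_conjTranspose,
    rotMajorana_conjTranspose, rotMajorana_anticomm_pair hO]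
  simp

lemma rotMajorana_mul_modeParity_zero (hO : O * Oᵀ = 1) (j : Fin n) :
    rotMajorana O (0, j) * modeParity O j = Complex.I • rotMajorana O (1, j) := by
  rw [modeParity, mul_smul_comm, ← mul_assoc, rotMajorana_mul_self hO, one_mul]

lemma modeParity_mul_rotMajorana_zero (hO : O * Oᵀ = 1) (j : Fin n) :
    modeParity O j * rotMajorana O (0, j) = -(Complex.I • rotMajorana O (1, j)) := by
  rw [modeParity, smul_mul_assoc, mul_assoc, rotMajorana_anticomm_pair hO, mul_neg, ← mul_assoc,
    rotMajorana_mul_self hO, one_mul, smul_neg]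

lemma rotMajorana_mul_modeParity_one (hO : O * Oᵀ = 1) (j : Fin n) :
    rotMajorana O (1, j) * modeParity O j = -(Complex.I • rotMajorana O (0, j)) := by
  rw [modeParity, mul_smul_comm, ← mul_assoc, rotMajorana_anticomm_pair hO, neg_mul, mul_assoc,
    rotMajorana_mul_self hO, mul_one, smul_neg]

lemma modeParity_mul_rotMajorana_one (hO : O * Oᵀ = 1) (j : Fin n) :
    modeParity O j * rotMajorana O (1, j) = Complex.I • rotMajorana O (0, j) := by
  rw [modeParity, smul_mul_assoc, mul_assoc, rotMajorana_mul_self hO, mul_one]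

lemma commute_rotMajorana_modeParity (hO : O * Oᵀ = 1) (s : Fin 2) {i j : Fin n} (hij : i ≠ j) :
    Commute (rotMajorana O (s, i)) (modeParity O j) := by
  have h0 : rotMajorana O (s, i) * rotMajorana O (0, j) =
      -(rotMajorana O (0, j) * rotMajorana O (s, i)) := rotMajorana_anticomm hO (by simp [hij])
  have h1 : rotMajorana O (s, i) * rotMajorana O (1, j) =
      -(rotMajorana O (1, j) * rotMajorana O (s, i)) := rotMajorana_anticomm hO (by simp [hij])
  rw [commute_iff_eq, modeParity, mul_smul_comm, smul_mul_assoc, ← mul_assoc, h0, neg_mul,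
    mul_assoc, h1, mul_neg, neg_neg, mul_assoc]

lemma commute_modeParity (hO : O * Oᵀ = 1) {i j : Fin n} (hij : i ≠ j) :
    Commute (modeParity O i) (modeParity O j) :=
  ((commute_rotMajorana_modeParity hO 0 hij).mul_left
    (commute_rotMajorana_modeParity hO 1 hij)).smul_left _

lemma commute_parity_modeParity (j : Fin n) : Commute (parity n) (modeParity O j) := by
  rw [commute_iff_eq, modeParity, mul_smul_comm, smul_mul_assoc, ← mul_assoc,
    parity_mul_rotMajorana, neg_mul, mul_assoc, parity_mul_rotMajorana, mul_neg, neg_neg,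
    mul_assoc]

/-- The product of the commuting factors `x_j + y_j Q_j`, where the `Q_j` are the parities of the
rotated modes. -/
def modeProduct (O : Matrix (Fin 2 × Fin n) (Fin (2 * n)) ℝ) (x y : Fin n → ℝ) : FockOp n :=
  (List.ofFn fun j => (x j : ℂ) • (1 : FockOp n) + (y j : ℂ) • modeParity O j).prod

lemma commute_modeFactor (hO : O * Oᵀ = 1) {i j : Fin n} (hij : i ≠ j) (x y x' y' : ℂ) :
    Commute (x • (1 : FockOp n) + y • modeParity O i) (x' • 1 + y' • modeParity O j) :=
  Commute.add_left ((Commute.one_left _).smul_left _)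
    ((((Commute.one_right _).smul_right _).add_right
      ((commute_modeParity hO hij).smul_right _)).smul_left _)

lemma trace_modeProduct (hO : O * Oᵀ = 1) (x y : Fin n → ℝ) :
    (modeProduct O x y).trace = ((∏ j, 2 * x j : ℝ) : ℂ) := by
  rw [modeProduct, trace_ofFn_prod _ _ (modeParity O) (fun j => rotMajorana O (0, j))
    (fun j => rotMajorana_mul_self hO _)
    (fun j => by rw [rotMajorana_mul_modeParity_zero hO, modeParity_mul_rotMajorana_zero hO,
      neg_neg])
    (fun i j hij => commute_rotMajorana_modeParity hO 0 hij)]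
  simp [Finset.prod_mul_distrib, mul_comm]

lemma modeProduct_mul_self (hO : O * Oᵀ = 1) (x y : Fin n → ℝ) :
    modeProduct O x y * modeProduct O x y =
      modeProduct O (fun j => x j ^ 2 + y j ^ 2) (fun j => 2 * x j * y j) := by
  rw [modeProduct, ofFn_prod_mul_ofFn_prod _ _ fun i j hij => commute_modeFactor hO hij _ _ _ _,
    modeProduct]
  congr 2
  ext1 j
  simp only [add_mul, mul_add, smul_mul_smul_comm, one_mul, mul_one, modeParity_mul_self hO]
  push_cast
  module

lemma posSemidef_one_add_modeParity (hO : O * Oᵀ = 1) (j : Fin n) :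
    ((1 / 2 : ℂ) • (1 + modeParity O j)).PosSemidef := by
  have h : (1 / 2 : ℂ) • (1 + modeParity O j) =
      ((1 / 2 : ℂ) • (1 + modeParity O j))ᴴ * ((1 / 2 : ℂ) • (1 + modeParity O j)) := by
    rw [Matrix.conjTranspose_smul, Matrix.conjTranspose_add, Matrix.conjTranspose_one,
      modeParity_conjTranspose hO, smul_mul_smul_comm, add_mul, mul_add, mul_add,
      modeParity_mul_self hO, one_mul, one_mul, mul_one]
    simp only [one_div, star_inv₀, star_ofNat]
    module
  rw [h]
  exact Matrix.posSemidef_conjTranspose_mul_self _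

lemma posSemidef_one_sub_modeParity (hO : O * Oᵀ = 1) (j : Fin n) :
    ((1 / 2 : ℂ) • (1 - modeParity O j)).PosSemidef := by
  have h : (1 / 2 : ℂ) • (1 - modeParity O j) =
      ((1 / 2 : ℂ) • (1 - modeParity O j))ᴴ * ((1 / 2 : ℂ) • (1 - modeParity O j)) := by
    rw [Matrix.conjTranspose_smul, Matrix.conjTranspose_sub, Matrix.conjTranspose_one,
      modeParity_conjTranspose hO, smul_mul_smul_comm, sub_mul, mul_sub, mul_sub,
      modeParity_mul_self hO, one_mul, one_mul, mul_one]
    simp only [one_div, star_inv₀, star_ofNat]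
    module
  rw [h]
  exact Matrix.posSemidef_conjTranspose_mul_self _

/-- With the spectral projections `(1 ± Q_j)/2`, the factor `x_j + y_j Q_j` has eigenvalues `x_j ±
y_j`, and products of commuting positive factors are positive. -/
lemma posSemidef_modeProduct (hO : O * Oᵀ = 1) (x y : Fin n → ℝ) (h1 : ∀ j, 0 ≤ x j + y j)
    (h2 : ∀ j, 0 ≤ x j - y j) : (modeProduct O x y).PosSemidef := by
  refine posSemidef_ofFn_prod _ (fun j => ?_) fun i j hij => commute_modeFactor hO hij _ _ _ _
  have h : (x j : ℂ) • (1 : FockOp n) + (y j : ℂ) • modeParity O j =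
      ((x j + y j : ℝ) : ℂ) • ((1 / 2 : ℂ) • (1 + modeParity O j)) +
        ((x j - y j : ℝ) : ℂ) • ((1 / 2 : ℂ) • (1 - modeParity O j)) := by
    push_cast
    module
  rw [h]
  exact ((posSemidef_one_add_modeParity hO j).smul (by exact_mod_cast h1 j)).add
    ((posSemidef_one_sub_modeParity hO j).smul (by exact_mod_cast h2 j))

lemma commute_modeProduct_parity (x y : Fin n → ℝ) : Commute (modeProduct O x y) (parity n) := by
  refine Commute.list_prod_left _ _ fun z hz => ?_
  obtain ⟨j, rfl⟩ := (List.mem_ofFn' _ _).1 hz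
  exact Commute.add_left ((Commute.one_left _).smul_left _)
    ((commute_parity_modeParity j).symm.smul_left _)

/-- The Gaussian density operator with normal mode parameters `a_j`. -/
def thermalOp (O : Matrix (Fin 2 × Fin n) (Fin (2 * n)) ℝ) (a : Fin n → ℝ) : FockOp n :=
  modeProduct O (fun _ => 1 / 2) (fun j => a j / 2)

/-- Only the factor `F = (1 + a_j Q_j)/2` fails to commute with the rotated pair `u, v` of mode `j`.
From `u Q_j = i v = -Q_j u` and `v Q_j = -Q_j v` one gets `[u, F] = i a_j v` and `v F + F v = v`;
exchanging `u` and `v` flips the sign of `a_j`. -/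
lemma commutator_thermalOp (hO : O * Oᵀ = 1) (a : Fin n → ℝ) (p : Fin 2 × Fin n) :
    rotMajorana O p * thermalOp O a - thermalOp O a * rotMajorana O p =
      ∑ q, (Complex.I * (skewBlocks a p q : ℂ)) •
        (rotMajorana O q * thermalOp O a + thermalOp O a * rotMajorana O q) := by
  obtain ⟨s, j⟩ := p
  have hcomm : ∀ (t : Fin 2) (i : Fin n), i ≠ j → Commute (rotMajorana O (t, j))
      (((1 / 2 : ℝ) : ℂ) • (1 : FockOp n) + ((a i / 2 : ℝ) : ℂ) • modeParity O i) :=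
    fun t i hij => ((Commute.one_right _).smul_right _).add_right
      ((commute_rotMajorana_modeParity hO t hij.symm).smul_right _)
  have h0 := commutator_ofFn_prod
    (fun i => ((1 / 2 : ℝ) : ℂ) • (1 : FockOp n) + ((a i / 2 : ℝ) : ℂ) • modeParity O i) j
    (rotMajorana O (0, j)) (rotMajorana O (1, j)) (Complex.I * a j) (by
      simp only [mul_add, add_mul, mul_smul_comm, smul_mul_assoc, mul_one, one_mul,
        rotMajorana_mul_modeParity_zero hO, modeParity_mul_rotMajorana_zero hO,
        rotMajorana_mul_modeParity_one hO, modeParity_mul_rotMajorana_one hO]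
      push_cast
      module) (hcomm 0) (hcomm 1)
  have h1 := commutator_ofFn_prod
    (fun i => ((1 / 2 : ℝ) : ℂ) • (1 : FockOp n) + ((a i / 2 : ℝ) : ℂ) • modeParity O i) j
    (rotMajorana O (1, j)) (rotMajorana O (0, j)) (Complex.I * (-a j : ℝ)) (by
      simp only [mul_add, add_mul, mul_smul_comm, smul_mul_assoc, mul_one, one_mul,
        rotMajorana_mul_modeParity_zero hO, modeParity_mul_rotMajorana_zero hO,
        rotMajorana_mul_modeParity_one hO, modeParity_mul_rotMajorana_one hO]
      push_cast
      module) (hcomm 1) (hcomm 0)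
  have hsum : ∀ (s : Fin 2) (f : Fin 2 × Fin n → FockOp n),
      ∑ q, (Complex.I * (skewBlocks a (s, j) q : ℂ)) • f q =
        (Complex.I * ((!![0, a j; -a j, 0] s 0 : ℝ) : ℂ)) • f (0, j) +
        (Complex.I * ((!![0, a j; -a j, 0] s 1 : ℝ) : ℂ)) • f (1, j) := by
    intro s f
    rw [Fintype.sum_prod_type, Fin.sum_univ_two]
    congr 1 <;>
    · rw [Finset.sum_eq_single j]
      · simp [skewBlocks, Matrix.blockDiagonal_apply]
      · intro i _ hi
        simp [skewBlocks, Matrix.blockDiagonal_apply, hi.symm]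
      · simp
  rw [hsum s]
  fin_cases s
  · simpa [thermalOp, modeProduct] using h0
  · simpa [thermalOp, modeProduct] using h1

/-- The thermal relation is linear in the Majorana operators, so it transforms along with the
covariance matrix under `O`. -/
lemma isThermal_thermalOp (hO : O * Oᵀ = 1) (hO' : Oᵀ * O = 1) {a : Fin n → ℝ}
    {γ : Matrix (Fin (2 * n)) (Fin (2 * n)) ℝ} (hγ : O * γ * Oᵀ = skewBlocks a) :
    IsThermal γ (thermalOp O a) := by
  intro j
  have hγ' : γ = Oᵀ * skewBlocks a * O := by
    rw [← hγ]
    calc γ = (Oᵀ * O) * γ * (Oᵀ * O) := by rw [hO', Matrix.one_mul, Matrix.mul_one]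
      _ = Oᵀ * (O * γ * Oᵀ) * O := by simp only [Matrix.mul_assoc]
  set σ := thermalOp O a
  have hl : majorana j * σ - σ * majorana j =
      ∑ p, (O p j : ℂ) • (rotMajorana O p * σ - σ * rotMajorana O p) := by
    rw [majorana_eq_sum_rotMajorana hO' j]
    simp only [Finset.sum_mul, Finset.mul_sum, smul_mul_assoc, mul_smul_comm, smul_sub,
      Finset.sum_sub_distrib]
  have hr : ∀ q, rotMajorana O q * σ + σ * rotMajorana O q =
      ∑ l, (O q l : ℂ) • (majorana l * σ + σ * majorana l) := by
    intro q
    simp only [rotMajorana, Finset.sum_mul, Finset.mul_sum, smul_mul_assoc, mul_smul_comm,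
      smul_add, Finset.sum_add_distrib]
  have hentry : ∀ l, (γ j l : ℂ) = ∑ p, ∑ q, (O p j : ℂ) * (skewBlocks a p q : ℂ) * (O q l : ℂ) := by
    intro l
    rw [hγ']
    simp only [Matrix.mul_apply, Matrix.transpose_apply, Finset.sum_mul]
    push_cast
    rw [Finset.sum_comm]
  have hc : ∀ p, rotMajorana O p * σ - σ * rotMajorana O p =
      ∑ q, (Complex.I * (skewBlocks a p q : ℂ)) • (rotMajorana O q * σ + σ * rotMajorana O q) :=
    commutator_thermalOp hO a
  rw [hl]
  simp only [hc, hr, hentry, Finset.smul_sum, Finset.mul_sum, Finset.sum_smul, smul_smul]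
  conv_rhs => rw [Finset.sum_comm]
  refine Finset.sum_congr rfl fun p _ => ?_
  conv_rhs => rw [Finset.sum_comm]
  refine Finset.sum_congr rfl fun q _ => Finset.sum_congr rfl fun l _ => ?_
  congr 1
  ring

end Rotation

/-! ### Gaussian states -/

lemma covariance_transpose {k : ℕ} (ρ : FockOp k) : (covariance ρ)ᵀ = -covariance ρ := by
  ext j l
  rw [Matrix.transpose_apply, Matrix.neg_apply, covariance, covariance, ← Complex.neg_re,
    ← mul_neg, ← Matrix.trace_neg, ← mul_neg, neg_sub]

/-- An operator with the moments of a thermal operator agrees with it. -/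
lemma eq_of_isThermal {k : ℕ} {σ σ' : FockOp k} {γ : Matrix (Fin (2 * k)) (Fin (2 * k)) ℝ}
    (hodd : ∀ (q : ℕ) (j : Fin q → Fin (2 * k)), Odd q → (σ * majoranaProd j).trace = 0)
    (hwick : ∀ (p : ℕ) (j : Fin (2 * p) → Fin (2 * k)), Function.Injective j →
      (σ * majoranaProd j).trace = (-Complex.I) ^ p * ((wickSum γ j : ℝ) : ℂ))
    (h : IsThermal γ σ') (htr : σ'.trace = 1) (hpar : Commute σ' (parity k)) : σ = σ' := by
  refine eq_of_trace_mul_monomial fun τ => ?_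
  obtain ⟨q, j, hj, hτ⟩ := exists_orderedMonomial_eq majorana τ
  have hτ' : monomial τ = majoranaProd j := hτ
  rw [hτ']
  rcases Nat.even_or_odd' q with ⟨p, rfl | rfl⟩
  · rw [hwick p j hj, h.trace_eq_wickSum htr p j hj]
  · rw [hodd _ j ⟨p, rfl⟩, trace_mul_majoranaProd_of_odd hpar ⟨p, rfl⟩]

lemma re_trace_mul_nonneg {ι : Type*} [Fintype ι] [DecidableEq ι] {P Q : Matrix ι ι ℂ}
    (hP : P.PosSemidef) (hQ : Q.PosSemidef) : 0 ≤ (P * Q).trace.re := by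
  obtain ⟨R, hR, rfl⟩ := exists_posSemidef_sqrt hQ
  have h := (hP.mul_mul_conjTranspose_same R).trace_nonneg
  rw [hR.isHermitian.eq, Matrix.trace_mul_comm, ← mul_assoc, Matrix.trace_mul_comm] at h
  exact (Complex.le_def.1 h).1

/-- `Q_j` is `i/2` times the commutator of its rotated pair, so its expectation is an off-diagonal
entry of the rotated covariance matrix. -/
lemma trace_mul_modeParity {n : ℕ} {O : Matrix (Fin 2 × Fin n) (Fin (2 * n)) ℝ}
    (hO : O * Oᵀ = 1) (σ : FockOp n) {a : Fin n → ℝ}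
    (h : O * covariance σ * Oᵀ = skewBlocks a) (j : Fin n) :
    (σ * modeParity O j).trace.re = a j := by
  have h1 : modeParity O j = (Complex.I / 2) • (rotMajorana O (0, j) * rotMajorana O (1, j) -
      rotMajorana O (1, j) * rotMajorana O (0, j)) := by
    rw [modeParity, rotMajorana_anticomm_pair hO]
    module
  have h2 : a j = (O * covariance σ * Oᵀ) (0, j) (1, j) := by
    rw [h]
    simp [skewBlocks, Matrix.blockDiagonal_apply]
  have h3 : rotMajorana O (0, j) * rotMajorana O (1, j) -
      rotMajorana O (1, j) * rotMajorana O (0, j) = ∑ l, ∑ l', ((O (0, j) l * O (1, j) l' : ℝ) : ℂ) •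
        (majorana l * majorana l' - majorana l' * majorana l) := by
    simp only [rotMajorana, Finset.sum_mul_sum, smul_mul_smul_comm, smul_sub,
      Finset.sum_sub_distrib, Complex.ofReal_mul]
    congr 1
    rw [Finset.sum_comm]
    simp only [mul_comm]
  rw [h2, h1, h3]
  simp only [mul_smul_comm, Finset.mul_sum, Finset.smul_sum, Matrix.trace_sum, Matrix.trace_smul,
    Complex.re_sum, Matrix.mul_apply, Matrix.transpose_apply, Finset.sum_mul, covariance]
  rw [Finset.sum_comm]
  refine Finset.sum_congr rfl fun l' _ => Finset.sum_congr rfl fun l _ => ?_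
  rw [smul_comm, Complex.coe_smul, Complex.smul_re, smul_eq_mul, smul_eq_mul]
  ring

/-- Spectrum of the covariance matrix and trace of the square root of a Gaussian state. -/
lemma gaussian_spectrum {n : ℕ} {σ : FockOp n} (hpos : σ.PosSemidef)
    (hodd : ∀ (q : ℕ) (j : Fin q → Fin (2 * n)), Odd q → (σ * majoranaProd j).trace = 0)
    (hwick : ∀ (p : ℕ) (j : Fin (2 * p) → Fin (2 * n)), Function.Injective j →
      (σ * majoranaProd j).trace = (-Complex.I) ^ p * ((wickSum (covariance σ) j : ℝ) : ℂ)) :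
    ∃ a : Fin n → ℝ, HasSpectrum (covariance σ) a ∧ (∀ j, |a j| ≤ 1) ∧
      sqrtTrace σ ^ 2 = ∏ j, g (a j) := by
  obtain ⟨O, a, hO, hO', hγ⟩ := exists_orthogonal_skewBlocks _ (covariance_transpose σ)
  -- Normalization is Wick's formula for the empty product.
  have htr : σ.trace = 1 := by
    have := hwick 0 Fin.elim0 fun i => i.elim0
    rw [wickSum_zero] at this
    simpa [majoranaProd] using this
  have hthermal : (thermalOp O a).trace = 1 := by
    rw [thermalOp, trace_modeProduct hO]
    simp
  have hσ : σ = thermalOp O a :=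
    eq_of_isThermal hodd hwick (isThermal_thermalOp hO hO' hγ) hthermal
      (commute_modeProduct_parity _ _)
  -- The projections `(1 ± Q_j)/2` have nonnegative expectations `(1 ± a_j)/2`.
  have hle : ∀ j, |a j| ≤ 1 := by
    intro j
    have h1 := re_trace_mul_nonneg hpos (posSemidef_one_add_modeParity hO j)
    have h2 := re_trace_mul_nonneg hpos (posSemidef_one_sub_modeParity hO j)
    have h3 := trace_mul_modeParity hO σ hγ j
    have hhalf : (1 / 2 : ℂ) = ((1 / 2 : ℝ) : ℂ) := by norm_num
    rw [mul_smul_comm, Matrix.trace_smul, mul_add, mul_one, Matrix.trace_add, htr, hhalf,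
      Complex.coe_smul, Complex.smul_re, Complex.add_re, h3, Complex.one_re, smul_eq_mul] at h1
    rw [mul_smul_comm, Matrix.trace_smul, mul_sub, mul_one, Matrix.trace_sub, htr, hhalf,
      Complex.coe_smul, Complex.smul_re, Complex.sub_re, h3, Complex.one_re, smul_eq_mul] at h2
    rw [abs_le]
    constructor <;> linarith
  refine ⟨a, hasSpectrum_of_skewBlocks hO' hγ, hle, ?_⟩
  -- `s j` and `t j` are the square roots of the eigenvalues of the `j`-th factor of `σ`. The root
  -- of that factor is `(s + t)/2 + (s - t)/2 * Q_j`; it contributes `s + t` to the trace, and `(s +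
  -- t)² = 1 + 2 s t = g (a j)`.
  set s : Fin n → ℝ := fun j => √((1 + a j) / 2) with hs
  set t : Fin n → ℝ := fun j => √((1 - a j) / 2) with ht
  have hs2 : ∀ j, s j ^ 2 = (1 + a j) / 2 := fun j =>
    Real.sq_sqrt (by have := abs_le.1 (hle j); linarith)
  have ht2 : ∀ j, t j ^ 2 = (1 - a j) / 2 := fun j =>
    Real.sq_sqrt (by have := abs_le.1 (hle j); linarith)
  have hst : ∀ j, 2 * (s j * t j) = √(1 - a j ^ 2) := by
    intro j
    rw [hs, ht, ← Real.sqrt_mul (by have := abs_le.1 (hle j); linarith),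
      show (1 + a j) / 2 * ((1 - a j) / 2) = (1 - a j ^ 2) / 2 ^ 2 by ring,
      Real.sqrt_div' _ (by positivity), Real.sqrt_sq (by norm_num)]
    ring
  have hsq : modeProduct O (fun j => (s j + t j) / 2) (fun j => (s j - t j) / 2) *
      modeProduct O (fun j => (s j + t j) / 2) (fun j => (s j - t j) / 2) = σ := by
    rw [modeProduct_mul_self hO, hσ, thermalOp]
    congr 1
    · ext j
      linear_combination (hs2 j + ht2 j) / 2
    · ext j
      linear_combination (hs2 j - ht2 j) / 2
  have hR := posSemidef_modeProduct hO (fun j => (s j + t j) / 2) (fun j => (s j - t j) / 2)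
    (fun j => by have : 0 ≤ s j := Real.sqrt_nonneg _; linarith)
    (fun j => by have : 0 ≤ t j := Real.sqrt_nonneg _; linarith)
  rw [← hsq, sqrtTrace_mul_self hR, trace_modeProduct hO, Complex.ofReal_re, ← Finset.prod_pow]
  refine Finset.prod_congr rfl fun j _ => ?_
  rw [g, ← hst]
  linear_combination hs2 j + ht2 j

lemma mem_of_hasSpectrum {n : ℕ} {M : Matrix (Fin (2 * n)) (Fin (2 * n)) ℝ} {a b : Fin n → ℝ}
    (ha : HasSpectrum M a) (hb : HasSpectrum M b) (j : Fin n) : ∃ l, a j = b l ∨ a j = -b l := by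
  have h : Complex.I * (a j : ℂ) ∈
      ∑ l : Fin n, ({Complex.I * (b l : ℂ), -(Complex.I * (b l : ℂ))} : Multiset ℂ) := by
    rw [← show (M.map (fun x : ℝ => (x : ℂ))).charpoly.roots = _ from hb,
      show (M.map (fun x : ℝ => (x : ℂ))).charpoly.roots = _ from ha]
    exact Multiset.mem_sum.2 ⟨j, Finset.mem_univ j, by simp⟩
  obtain ⟨l, _, hl⟩ := Multiset.mem_sum.1 h
  refine ⟨l, ?_⟩
  simp only [Multiset.insert_eq_cons, Multiset.mem_cons, Multiset.mem_singleton, ← mul_neg,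
    mul_right_inj' Complex.I_ne_zero] at hl
  exact_mod_cast hl

/-- The spectrum fixes the `a j` only up to order and sign. As `g` is even, the product of `g z.im`
over all roots is the square of the product in question, which is nonnegative. -/
lemma prod_g_eq_of_hasSpectrum {n : ℕ} {M : Matrix (Fin (2 * n)) (Fin (2 * n)) ℝ}
    {a b : Fin n → ℝ} (ha : HasSpectrum M a) (hb : HasSpectrum M b) :
    ∏ j, g (a j) = ∏ j, g (b j) := by
  have key : ∀ c : Fin n → ℝ, HasSpectrum M c →
      ((M.map (fun x : ℝ => (x : ℂ))).charpoly.roots.map fun z => g z.im).prod =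
        (∏ j, g (c j)) ^ 2 := by
    intro c hc
    rw [show (M.map (fun x : ℝ => (x : ℂ))).charpoly.roots = _ from hc,
      ← Multiset.coe_mapAddMonoidHom, map_sum, Multiset.prod_sum, ← Finset.prod_pow]
    refine Finset.prod_congr rfl fun j _ => ?_
    simp [g, sq]
  have hpos : ∀ c : Fin n → ℝ, 0 ≤ ∏ j, g (c j) := fun c =>
    Finset.prod_nonneg fun j _ => by
      have := Real.sqrt_nonneg (1 - c j ^ 2)
      unfold g
      linarith
  exact (pow_left_inj₀ (hpos a) (hpos b) two_ne_zero).1 ((key a ha).symm.trans (key b hb))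

/-- The expectation values of the reduced state of a pure state. -/
lemma trace_reduced_mul_majoranaProd {n q : ℕ} (ψ : Finset (Fin (n + n)) → ℂ)
    (j : Fin q → Fin (2 * n)) :
    (coeffMatrix ψ * (coeffMatrix ψ)ᴴ * majoranaProd j).trace =
      (Matrix.vecMulVec ψ (star ψ) * majoranaProd fun i => indexA (j i)).trace :=
  (trace_pure_mul ψ (tensorIso_majoranaProd j)).symm

lemma covariance_reduced {n : ℕ} (ψ : Finset (Fin (n + n)) → ℂ) :
    covariance (coeffMatrix ψ * (coeffMatrix ψ)ᴴ) =
      reducedCovariance n n (Matrix.vecMulVec ψ (star ψ)) := by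
  have h2 : ∀ {k : ℕ} (a b : Fin (2 * k)), majorana a * majorana b = majoranaProd ![a, b] :=
    fun a b => by simp [majoranaProd]
  ext j l
  change _ = covariance (Matrix.vecMulVec ψ (star ψ)) (indexA j) (indexA l)
  simp only [covariance, mul_sub, Matrix.trace_sub, h2, trace_reduced_mul_majoranaProd]
  have h3 : ∀ a b : Fin (2 * n), (fun i => indexA (![a, b] i)) =
      ![(indexA a : Fin (2 * (n + n))), indexA b] := by
    intro a b
    ext i
    fin_cases i <;> rfl
  rw [h3, h3]

end FermionicNegativity
end

/-! ### Negativity of pure Gaussian states -/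

open FermionicNegativity in
theorem lemma2 (n : ℕ) (ρ : FockOp (n + n)) (hgauss : IsGaussianState ρ) (hpure : IsPure ρ) :
    (∃ a : Fin n → ℝ, HasSpectrum (reducedCovariance n n ρ) a) ∧
      ∀ a : Fin n → ℝ, HasSpectrum (reducedCovariance n n ρ) a →
        (∀ j, |a j| ≤ 1) ∧
          negativity n n ρ = 1 / 2 * (∏ j, g (a j) - 1) := by
  obtain ⟨ψ, rfl⟩ := hpure
  have hindex : Function.Injective (indexA : Fin (2 * n) → Fin (2 * (n + n))) :=
    Fin.castLE_injective (by omega)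
  -- The reduced state inherits vanishing odd moments and Wick's formula from `ρ`, because Majorana
  -- products of `A` are Majorana products of the whole system.
  obtain ⟨b, hb, hle, hsqrt⟩ := gaussian_spectrum
    (Matrix.posSemidef_self_mul_conjTranspose (coeffMatrix ψ))
    (fun q j hq => by
      rw [trace_reduced_mul_majoranaProd, trace_mul_majoranaProd_of_odd hgauss.commute_parity hq])
    (fun p j hj => by
      rw [trace_reduced_mul_majoranaProd, covariance_reduced]
      exact hgauss.wick p (fun i => indexA (j i)) (hindex.comp hj))
  rw [covariance_reduced] at hb
  refine ⟨⟨b, hb⟩, fun a ha => ⟨fun j => ?_, ?_⟩⟩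
  · obtain ⟨l, hl | hl⟩ := mem_of_hasSpectrum ha hb j
    · rw [hl]
      exact hle l
    · rw [hl, abs_neg]
      exact hle l
  · rw [negativity, traceNorm_partialTranspose_pure, hsqrt, prod_g_eq_of_hasSpectrum ha hb]
    ring
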